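/- Let $\chi$ be a topological space with its Borel $\sigma$-algebra and a $\sigma$-finite measure $\nu$, and let $\mu$ be a $\sigma$-finite Borel measure on $\mathbb R^d$. Let $\Theta,\Theta_0\subset\mathbb R^d$ be compact, let $\widehat\Theta\supseteq\Theta\cup\Theta_0$ be closed and convex, $\Theta_H\subset\widehat\Theta$ finite, $\chi_c\subset\chi$ compact, and put $S=\Theta\cup\Theta_0$. Let $p(x|\theta)$ be a jointly measurable kernel such that $p(\cdot|\theta)$ is a probability density with respect to $\nu$ for $\theta\in\widehat\Theta$, and $p(x|\theta)>0$ for all $x\in\chi$, $\theta\in S\cup\Theta_H$. For a density $g$ with respect to $\mu$ write $m_g(x)=\int p(x|\theta)g(\theta)\,\mu(d\theta)$. Let $q\ge1$ and let $X_1,X_2,\dots$ be $\chi$-valued random variables that are $(q-1)$-dependent, i.e. for every $k$ the families $(X_i)_{i\le k}$ and $(X_i)_{i\ge k+q}$ are independent, and all have the density $m=m_f$ with respect to $\nu$, where $f$ is a $\mu$-density supported on $\Theta$. Let $f_0$ be a $\mu$-density supported on $\Theta_0$, and define $$f_i(\theta)=(1-w_i)f_{i-1}(\theta)+w_i\frac{p(X_i|\theta)f_{i-1}(\theta)}{m_{i-1}(X_i)},\qquad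 m_i=m_{f_i},\quad i\ge1 .$$ Let $\mathcal F_0$ be the set of all $\mu$-densities supported on $\Theta_0$, let $KL(g,h)=\int g\log(g/h)$ denote the Kullback–Leibler divergence, and put $\tilde k=\inf_{g\in\mathcal F_0}KL(m,m_g)$, $K_n^*=KL(m,m_n)$, $\tilde K_n^*=K_n^*-\tilde k$. Assume that there is a $\mu$-a.e. unique $\tilde f\in\mathcal F_0$ with $KL(m,m_{\tilde f})=\tilde k$, and that $KL(\tilde f,f_0)<\infty$. Assume moreover: * (A1) $w_n\in(0,1]$, $w_n\downarrow0$, $\sum_i w_{j+iq}=\infty$ for $j=1,\dots,q$, and $\sum_i w_i^2<\infty$. * (A2) Densities $g,h$ supported on $\Theta$ with $m_g=m_h$ $\nu$-a.e. coincide $\mu$-a.e. * (A3) For each $x$, $\theta\mapsto p(x|\theta)$ is bounded and continuous on $S$. * (A4) There is $B<\infty$ with $\int\{p(x|\theta_1)/p(x|\theta_2)\}^k\,p(x|\theta_3)\,\nu(dx)<B$ for all $\theta_1,\theta_2\in S\cup\Theta_H$, $\theta_3\in\Theta$ and all integers $0\le k\le4q$. * (C1) There is $c_u>1$ such that for every $x\notin\chi_c$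 there are $\theta_1^x,\theta_2^x\in\Theta_H$ with $\sup_{\theta,\theta'\in S}p(x|\theta)/p(x|\theta')\le c_u\,p(x|\theta_2^x)/p(x|\theta_1^x)$. * (C2), (C3) There are $0<a\le b<\infty$ with $a\le p(x|\theta)\le b$ for all $x\in\chi_c$, $\theta\in S$. Let $\gamma\in(3/4,1)$ and suppose $w_i\sim i^{-\gamma}$ in the sense of order, i.e. $c_1i^{-\gamma}\le w_i\le c_2i^{-\gamma}$ for all large $i$ with constants $0<c_1\le c_2<\infty$. Then $\tilde k<\infty$, almost surely $K_n^*<\infty$ for all $n$, and for every $\gamma'\in(\gamma,1)$: $$n^{1-\gamma'}\tilde K_n^*\to0\quad\text{almost surely};$$ and if $m/m_{\tilde f}$ is bounded away from $0$ and $\infty$ ($\nu$-a.e.), then almost surely $H(m_{\tilde f},m_n)=o\big(n^{-(1-\gamma')/2}\big)$, where $H(g,h)=\big(\int(\sqrt g-\sqrt h)^2\,d\nu\big)^{1/2}$. -/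

import Mathlib

open MeasureTheory ProbabilityTheory Filter Topology Asymptotics
open scoped ENNReal

namespace PredRec

/-- The parameter space: `d`-dimensional Euclidean space. -/
abbrev Par (d : ℕ) : Type := EuclideanSpace ℝ (Fin d)

/-- `g` is a probability density with respect to `μ` that is supported on `S`. -/
structure IsDensityOn {E : Type*} [MeasurableSpace E] (μ : Measure E) (S : Set E)
    (g : E → ℝ) : Prop where
  measurable : Measurable g
  nonneg : ∀ θ, 0 ≤ g θ
  support : ∀ θ, θ ∉ S → g θ = 0
  total : ∫⁻ θ, ENNReal.ofReal (g θ) ∂μ = 1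

/-- The marginal (mixture) density `m_g(x) = ∫ p(x | θ) g(θ) dμ(θ)`. -/
noncomputable def mix {χ E : Type*} [MeasurableSpace E] (p : χ → E → ℝ) (μ : Measure E)
    (g : E → ℝ) (x : χ) : ℝ :=
  ∫ θ, p x θ * g θ ∂μ

/-- The predictive recursion driven by the observations `x 1, x 2, …` (the entries `x 0` and
`w 0` are not used):
`f_i(θ) = (1 - w_i) f_{i-1}(θ) + w_i p(x_i | θ) f_{i-1}(θ) / m_{i-1}(x_i)`. -/
noncomputable def recursion {χ E : Type*} [MeasurableSpace E] (p : χ → E → ℝ) (μ : Measure E)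
    (w : ℕ → ℝ) (f₀ : E → ℝ) (x : ℕ → χ) : ℕ → E → ℝ
  | 0 => f₀
  | i + 1 => fun θ =>
      (1 - w (i + 1)) * recursion p μ w f₀ x i θ
        + w (i + 1) * (p (x (i + 1)) θ * recursion p μ w f₀ x i θ
            / mix p μ (recursion p μ w f₀ x i) (x (i + 1)))

/-- Kullback–Leibler divergence `∫ g log (g / h) dρ` of the densities `g`, `h` with respect to the
base measure `ρ`, as an extended nonnegative number. -/
noncomputable def KL {α : Type*} [MeasurableSpace α] (ρ : Measure α) (g h : α → ℝ) : ℝ≥0∞ :=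
  InformationTheory.klDiv (ρ.withDensity fun x => ENNReal.ofReal (g x))
    (ρ.withDensity fun x => ENNReal.ofReal (h x))

/-- Hellinger distance `(∫ (√g - √h)² dρ)^{1/2}` of two densities. -/
noncomputable def hellinger {α : Type*} [MeasurableSpace α] (ρ : Measure α) (g h : α → ℝ) : ℝ :=
  Real.sqrt (∫ x, (Real.sqrt (g x) - Real.sqrt (h x)) ^ 2 ∂ρ)

/-- The infimum `k̃` of `KL(m, m_g)` over all densities `g` supported on `Θ₀`. -/
noncomputable def kInf {χ E : Type*} [MeasurableSpace χ] [MeasurableSpace E] (p : χ → E → ℝ)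
    (ν : Measure χ) (μ : Measure E) (Θ₀ : Set E) (m : χ → ℝ) : ℝ≥0∞ :=
  ⨅ g ∈ {g : E → ℝ | IsDensityOn μ Θ₀ g}, KL ν m (mix p μ g)

/-- `g` attains the infimum `k̃`, and every density on `Θ₀` attaining it equals `g` `μ`-a.e. -/
structure IsUniqueProjection {χ E : Type*} [MeasurableSpace χ] [MeasurableSpace E]
    (p : χ → E → ℝ) (ν : Measure χ) (μ : Measure E) (Θ₀ : Set E) (m : χ → ℝ)
    (g : E → ℝ) : Prop where
  density : IsDensityOn μ Θ₀ g
  attains : KL ν m (mix p μ g) = kInf p ν μ Θ₀ m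
  unique : ∀ h : E → ℝ, IsDensityOn μ Θ₀ h → KL ν m (mix p μ h) = kInf p ν μ Θ₀ m → h =ᵐ[μ] g

/-- The sequence `X 1, X 2, …` is `(q - 1)`-dependent: for every `k` the `σ`-algebras generated by
`(X_i)_{1 ≤ i ≤ k}` and by `(X_i)_{i ≥ k + q}` are independent. -/
def IsDependentOfGap {Ω χ : Type*} [MeasurableSpace Ω] [mχ : MeasurableSpace χ] (q : ℕ)
    (X : ℕ → Ω → χ) (P : Measure Ω) : Prop :=
  ∀ k : ℕ, Indep (⨆ i ∈ Set.Icc 1 k, MeasurableSpace.comap (X i) mχ)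
    (⨆ i ∈ Set.Ici (k + q), MeasurableSpace.comap (X i) mχ) P

/-- Condition A1 on the weights `w 1, w 2, …`, which lie in `(0, 1]`. -/
structure CondA1 (q : ℕ) (w : ℕ → ℝ) : Prop where
  pos : ∀ i, 1 ≤ i → 0 < w i
  le_one : ∀ i, 1 ≤ i → w i ≤ 1
  anti : AntitoneOn w (Set.Ici 1)
  tendsto_zero : Tendsto w atTop (𝓝 0)
  diverges : ∀ j ∈ Set.Icc 1 q, ¬ Summable fun i : ℕ => w (j + i * q)
  sq_summable : Summable fun i : ℕ => w i ^ 2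

/-- Condition A2: a mixing density on `Θ` is identifiable from its mixture. -/
def CondA2 {χ E : Type*} [MeasurableSpace χ] [MeasurableSpace E] (p : χ → E → ℝ)
    (ν : Measure χ) (μ : Measure E) (Θ : Set E) : Prop :=
  ∀ g h : E → ℝ, IsDensityOn μ Θ g → IsDensityOn μ Θ h →
    mix p μ g =ᵐ[ν] mix p μ h → g =ᵐ[μ] h

/-- Condition A3: `θ ↦ p(x | θ)` is bounded and continuous on `S`, for each `x`. -/
def CondA3 {χ E : Type*} [TopologicalSpace E] (p : χ → E → ℝ) (S : Set E) : Prop :=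
  ∀ x, ContinuousOn (p x) S ∧ ∃ C : ℝ, ∀ θ ∈ S, |p x θ| ≤ C

/-- Condition A4: `∫ (p(x|θ₁)/p(x|θ₂))^k p(x|θ₃) dν(x) < B` for `k ≤ 4q`, with one finite `B`, for
`θ₁, θ₂ ∈ T` and `θ₃ ∈ S`. -/
def CondA4 {χ E : Type*} [MeasurableSpace χ] (p : χ → E → ℝ) (ν : Measure χ) (q : ℕ)
    (T S : Set E) : Prop :=
  ∃ B : ℝ, 0 < B ∧ ∀ θ₁ ∈ T, ∀ θ₂ ∈ T, ∀ θ₃ ∈ S, ∀ k : ℕ, k ≤ 4 * q →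
    ∫⁻ x, ENNReal.ofReal ((p x θ₁ / p x θ₂) ^ k * p x θ₃) ∂ν < ENNReal.ofReal B

/-- Condition C1. -/
def CondC1 {χ E : Type*} (p : χ → E → ℝ) (S ΘH : Set E) (χc : Set χ) : Prop :=
  ∃ cu : ℝ, 1 < cu ∧ ∀ x, x ∉ χc → ∃ θ₁ ∈ ΘH, ∃ θ₂ ∈ ΘH, ∀ θ ∈ S, ∀ η ∈ S,
    p x θ / p x η ≤ cu * (p x θ₂ / p x θ₁)

/-- Condition C2. -/
def CondC2 {χ E : Type*} (p : χ → E → ℝ) (S : Set E) (χc : Set χ) : Prop :=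
  ∃ a : ℝ, 0 < a ∧ ∀ x ∈ χc, ∀ θ ∈ S, a ≤ p x θ

/-- Condition C3. -/
def CondC3 {χ E : Type*} (p : χ → E → ℝ) (S : Set E) (χc : Set χ) : Prop :=
  ∃ b : ℝ, ∀ x ∈ χc, ∀ θ ∈ S, p x θ ≤ b

end PredRec

/-! Let V_n = ∫ log(m_f̃ / m_n) m dν, which is the excess divergence K̃*_n and is nonnegative
because f̃ minimizes. Two Lyapunov functions are followed along the recursion.

The first is KL(f̃, f_n), on the parameter space. An observation y lowers it by w (m_f̃(y)/m_n(y) −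
1) up to a term of order w², and under m this excess has mean at least V_n, since log r ≤ r − 1
(`entropy_update`, `logRatio_le_integral_excess`). Hence Σ w_{n+q} V_n < ∞ almost surely.

The second is V_n itself. Its mean drift is, to first order, −w (∫ φ² f_n dμ − 1) with φ(θ) = ∫
p(x|θ) m(x)/m_n(x) ν(dx). As ∫ φ f_n dμ = 1, this is nonpositive (`integral_overlapExcess_nonneg`).
So, apart from convergent noise, n^{1−γ'} V_n grows by at most ((n+1)^{1−γ'} − n^{1−γ'}) V_n =
O(w_{n+q} V_n), which is summable, and therefore it converges to some L. Since Σ w_{n+q} / n^{1−γ'}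
= ∞, the first summability forces L = 0.

All error terms are controlled by one envelope Z ≥ 1 of the likelihood ratios on Θ ∪ Θ₀, which has a
fourth moment under m by C1–C3 and A4 (`exists_ratioBound`). Dependence is handled by evaluating the
drift at X_{k+q} on f_k instead of f_{k+q−1}: this costs O(w²) times fourth powers of Z
(`lagged_step`) and leaves terms centered given X_1, …, X_k. Such a series splits into q
martingales, one per residue class, each bounded in L². With weights n^{1−γ'} the noise needs Σ
n^{2(1−γ'−γ)} < ∞, whence γ > 3/4.

The Hellinger rate follows from c H² ≤ V_n (`hellinger_sq_le`), where first-order optimality of f̃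
removes the linear term. -/

namespace PredRec

/-! ### Densities, mixtures and one update under a likelihood-ratio envelope -/

section Densities

variable {χ E : Type*} [MeasurableSpace χ] [MeasurableSpace E]

/-- The ratios `p (x | θ) / p (x | η)` on `S` are bounded by `Z x`. -/
structure RatioBound (p : χ → E → ℝ) (S : Set E) (Z : χ → ℝ) : Prop where
  meas : Measurable (Function.uncurry p)
  pos : ∀ x, ∀ θ ∈ S, 0 < p x θ
  measZ : Measurable Z
  one_le : ∀ x, 1 ≤ Z x
  bound : ∀ x, ∀ θ ∈ S, ∀ η ∈ S, p x θ ≤ Z x * p x η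

/-- The mass of `p (x | ·) p (y | ·) g` relative to the product of the marginal densities. -/
noncomputable def overlap (p : χ → E → ℝ) (μ : Measure E) (g : E → ℝ) (x y : χ) : ℝ :=
  (∫ θ, p x θ * p y θ * g θ ∂μ) / (mix p μ g x * mix p μ g y)

/-- One step of the recursion. -/
noncomputable def update (p : χ → E → ℝ) (μ : Measure E) (g : E → ℝ) (w : ℝ) (y : χ) (θ : E) : ℝ :=
  (1 - w) * g θ + w * (p y θ * g θ / mix p μ g y)

variable {μ : Measure E} {S : Set E} {p : χ → E → ℝ} {Z : χ → ℝ} {g h : E → ℝ}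

namespace IsDensityOn

lemma mono {T : Set E} (hg : IsDensityOn μ S g) (hST : S ⊆ T) : IsDensityOn μ T g :=
  ⟨hg.measurable, hg.nonneg, fun θ hθ => hg.support θ fun h => hθ (hST h), hg.total⟩

lemma integrable (hg : IsDensityOn μ S g) : Integrable g μ := by
  refine ⟨hg.measurable.aestronglyMeasurable, ?_⟩
  rw [hasFiniteIntegral_iff_ofReal (Eventually.of_forall hg.nonneg), hg.total]
  exact ENNReal.one_lt_top

lemma integral_eq_one (hg : IsDensityOn μ S g) : ∫ θ, g θ ∂μ = 1 := by
  rw [integral_eq_lintegral_of_nonneg_ae (Eventually.of_forall hg.nonneg)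
    hg.measurable.aestronglyMeasurable, hg.total, ENNReal.toReal_one]

lemma of_integral (hm : Measurable g) (h0 : ∀ θ, 0 ≤ g θ) (hs : ∀ θ, θ ∉ S → g θ = 0)
    (hi : Integrable g μ) (h1 : ∫ θ, g θ ∂μ = 1) : IsDensityOn μ S g :=
  ⟨hm, h0, hs, by
    rw [← ofReal_integral_eq_lintegral_ofReal hi (Eventually.of_forall h0), h1, ENNReal.ofReal_one]⟩

lemma nonempty (hg : IsDensityOn μ S g) : S.Nonempty := by
  by_contra hS
  rw [Set.not_nonempty_iff_eq_empty] at hS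
  have h0 : ∀ θ, g θ = 0 := fun θ => hg.support θ (by simp [hS])
  have := hg.total
  simp [h0] at this

/-- Integrals of a function bounded by `C` on `S` against a density on `S`. -/
lemma integrable_mul (hg : IsDensityOn μ S g) {φ : E → ℝ} (hφ : Measurable φ) {C : ℝ}
    (hC : ∀ θ ∈ S, |φ θ| ≤ C) : Integrable (fun θ => φ θ * g θ) μ := by
  refine (hg.integrable.const_mul C).mono' (hφ.mul hg.measurable).aestronglyMeasurable
    (Eventually.of_forall fun θ => ?_)
  rw [Real.norm_eq_abs, abs_mul, abs_of_nonneg (hg.nonneg θ)]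
  by_cases hθ : θ ∈ S
  · exact mul_le_mul_of_nonneg_right (hC θ hθ) (hg.nonneg θ)
  · simp [hg.support θ hθ]

lemma integral_mul_le (hg : IsDensityOn μ S g) {φ : E → ℝ} (hφ : Measurable φ) {C c : ℝ}
    (hC : ∀ θ ∈ S, |φ θ| ≤ C) (hc : ∀ θ ∈ S, φ θ ≤ c) : ∫ θ, φ θ * g θ ∂μ ≤ c := by
  calc ∫ θ, φ θ * g θ ∂μ ≤ ∫ θ, c * g θ ∂μ := by
        refine integral_mono (hg.integrable_mul hφ hC) (hg.integrable.const_mul c) fun θ => ?_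
        by_cases hθ : θ ∈ S
        · exact mul_le_mul_of_nonneg_right (hc θ hθ) (hg.nonneg θ)
        · simp [hg.support θ hθ]
    _ = c := by rw [integral_const_mul, hg.integral_eq_one, mul_one]

lemma le_integral_mul (hg : IsDensityOn μ S g) {φ : E → ℝ} (hφ : Measurable φ) {C c : ℝ}
    (hC : ∀ θ ∈ S, |φ θ| ≤ C) (hc : ∀ θ ∈ S, c ≤ φ θ) : c ≤ ∫ θ, φ θ * g θ ∂μ := by
  calc c = ∫ θ, c * g θ ∂μ := by rw [integral_const_mul, hg.integral_eq_one, mul_one]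
    _ ≤ ∫ θ, φ θ * g θ ∂μ := by
        refine integral_mono (hg.integrable.const_mul c) (hg.integrable_mul hφ hC) fun θ => ?_
        by_cases hθ : θ ∈ S
        · exact mul_le_mul_of_nonneg_right (hc θ hθ) (hg.nonneg θ)
        · simp [hg.support θ hθ]

end IsDensityOn

namespace RatioBound

lemma measurable_right (hp : RatioBound p S Z) (x : χ) : Measurable (p x) :=
  hp.meas.comp measurable_prodMk_left

lemma measurable_left (hp : RatioBound p S Z) (θ : E) : Measurable fun x => p x θ :=
  hp.meas.comp measurable_prodMk_right

lemma Z_pos (hp : RatioBound p S Z) (x : χ) : 0 < Z x := one_pos.trans_le (hp.one_le x)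

lemma exists_abs_le (hp : RatioBound p S Z) (hS : S.Nonempty) (x : χ) :
    ∃ C, ∀ θ ∈ S, |p x θ| ≤ C := by
  obtain ⟨η, hη⟩ := hS
  exact ⟨_, fun θ hθ => by
    rw [abs_of_pos (hp.pos x θ hθ)]; exact hp.bound x θ hθ η hη⟩

lemma integrable (hp : RatioBound p S Z) (hg : IsDensityOn μ S g) (x : χ) :
    Integrable (fun θ => p x θ * g θ) μ := by
  obtain ⟨C, hC⟩ := hp.exists_abs_le hg.nonempty x
  exact hg.integrable_mul (hp.measurable_right x) hC

lemma mix_le (hp : RatioBound p S Z) (hg : IsDensityOn μ S g) (x : χ) {η : E} (hη : η ∈ S) :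
    mix p μ g x ≤ Z x * p x η := by
  obtain ⟨C, hC⟩ := hp.exists_abs_le hg.nonempty x
  exact hg.integral_mul_le (hp.measurable_right x) hC fun θ hθ => hp.bound x θ hθ η hη

lemma le_mix (hp : RatioBound p S Z) (hg : IsDensityOn μ S g) (x : χ) {η : E} (hη : η ∈ S) :
    p x η ≤ Z x * mix p μ g x := by
  obtain ⟨C, hC⟩ := hp.exists_abs_le hg.nonempty x
  have := hg.le_integral_mul (hp.measurable_right x) hC (c := p x η / Z x) fun θ hθ => by
    rw [div_le_iff₀' (hp.Z_pos x)]; exact hp.bound x η hη θ hθ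
  rwa [div_le_iff₀' (hp.Z_pos x)] at this

lemma mix_pos (hp : RatioBound p S Z) (hg : IsDensityOn μ S g) (x : χ) : 0 < mix p μ g x := by
  obtain ⟨η, hη⟩ := hg.nonempty
  exact pos_of_mul_pos_right ((hp.pos x η hη).trans_le (hp.le_mix hg x hη)) (hp.Z_pos x).le

lemma mix_le_mix (hp : RatioBound p S Z) (hg : IsDensityOn μ S g) (hh : IsDensityOn μ S h)
    (x : χ) : mix p μ h x ≤ Z x * mix p μ g x := by
  obtain ⟨C, hC⟩ := hp.exists_abs_le hg.nonempty x
  exact hh.integral_mul_le (hp.measurable_right x) hC fun θ hθ => hp.le_mix hg x hθ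

lemma measurable_mix (hp : RatioBound p S Z) [SFinite μ] (hg : Measurable g) :
    Measurable (mix p μ g) :=
  (StronglyMeasurable.integral_prod_right (f := fun x θ => p x θ * g θ)
    (hp.meas.mul (hg.comp measurable_snd)).stronglyMeasurable).measurable

lemma integrable_mul_mul (hp : RatioBound p S Z) (hg : IsDensityOn μ S g) (x y : χ) :
    Integrable (fun θ => p x θ * p y θ * g θ) μ := by
  obtain ⟨C, hC⟩ := hp.exists_abs_le hg.nonempty x
  obtain ⟨D, hD⟩ := hp.exists_abs_le hg.nonempty y
  refine hg.integrable_mul (C := C * D) ((hp.measurable_right x).mul (hp.measurable_right y))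
    fun θ hθ => ?_
  rw [abs_mul]
  exact mul_le_mul (hC θ hθ) (hD θ hθ) (abs_nonneg _) ((abs_nonneg _).trans (hC θ hθ))

/-- The overlap is the mean of p(y|θ)/m_g(y) under the posterior given x, so the bound involves the
envelope at y only. -/
lemma overlap_le (hp : RatioBound p S Z) (hg : IsDensityOn μ S g) (x y : χ) :
    overlap p μ g x y ≤ Z y := by
  have hx := hp.mix_pos hg x
  have hy := hp.mix_pos hg y
  rw [overlap, div_le_iff₀ (mul_pos hx hy)]
  calc ∫ θ, p x θ * p y θ * g θ ∂μ ≤ ∫ θ, (Z y * mix p μ g y) * (p x θ * g θ) ∂μ := by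
        refine integral_mono (hp.integrable_mul_mul hg x y)
          ((hp.integrable hg x).const_mul _) fun θ => ?_
        by_cases hθ : θ ∈ S
        · have := hp.le_mix hg y hθ
          have h1 := mul_nonneg (hp.pos x θ hθ).le (hg.nonneg θ)
          simp only
          nlinarith
        · simp [hg.support θ hθ]
    _ = Z y * (mix p μ g x * mix p μ g y) := by
        rw [integral_const_mul, mix, mix]; ring

lemma overlap_nonneg (hp : RatioBound p S Z) (hg : IsDensityOn μ S g) (x y : χ) :
    0 ≤ overlap p μ g x y := by
  refine div_nonneg (integral_nonneg fun θ => ?_)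
    (mul_pos (hp.mix_pos hg x) (hp.mix_pos hg y)).le
  by_cases hθ : θ ∈ S
  · exact mul_nonneg (mul_pos (hp.pos x θ hθ) (hp.pos y θ hθ)).le (hg.nonneg θ)
  · simp [hg.support θ hθ]

lemma div_mix_le (hp : RatioBound p S Z) (hg : IsDensityOn μ S g) (y : χ) {θ : E} (hθ : θ ∈ S) :
    p y θ / mix p μ g y ≤ Z y := by
  rw [div_le_iff₀ (hp.mix_pos hg y)]; exact hp.le_mix hg y hθ

lemma isDensityOn_update (hp : RatioBound p S Z) (hg : IsDensityOn μ S g) {w : ℝ} (hw : 0 ≤ w)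
    (hw1 : w ≤ 1) (y : χ) : IsDensityOn μ S (update p μ g w y) := by
  have hi := (hp.integrable hg y).div_const (mix p μ g y)
  refine .of_integral ?_ (fun θ => ?_) (fun θ hθ => by simp [update, hg.support θ hθ]) ?_ ?_
  · exact (hg.measurable.const_mul _).add
      ((((hp.measurable_right y).mul hg.measurable).div_const _).const_mul _)
  · by_cases hθ : θ ∈ S
    · have := hp.pos y θ hθ
      have := hp.mix_pos hg y
      have := hg.nonneg θ
      have : 0 ≤ 1 - w := by linarith
      unfold update; positivity
    · simp [update, hg.support θ hθ]
  · exact (hg.integrable.const_mul _).add (hi.const_mul _)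
  · unfold update
    rw [integral_add (hg.integrable.const_mul _) (hi.const_mul _), integral_const_mul,
      integral_const_mul, integral_div, hg.integral_eq_one]
    have : (∫ θ, p y θ * g θ ∂μ) / mix p μ g y = 1 := div_self (hp.mix_pos hg y).ne'
    rw [this]; ring

omit [MeasurableSpace χ] in
lemma update_eq (w : ℝ) (y : χ) (θ : E) :
    update p μ g w y θ = g θ * (1 + w * (p y θ / mix p μ g y - 1)) := by
  unfold update; ring

lemma update_le (hp : RatioBound p S Z) (hg : IsDensityOn μ S g) {w : ℝ} (hw : 0 ≤ w)
    (y : χ) (θ : E) : update p μ g w y θ ≤ (1 + 2 * (w * Z y)) * g θ := by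
  by_cases hθ : θ ∈ S
  · rw [update_eq, mul_comm]
    refine mul_le_mul_of_nonneg_right ?_ (hg.nonneg θ)
    have := mul_le_mul_of_nonneg_left (hp.div_mix_le hg y hθ) hw
    nlinarith [mul_nonneg hw (hp.Z_pos y).le]
  · simp [update, hg.support θ hθ]

/-- The old density loses at most the factor 1 − w, and (1 + 2wZ)(1 − w) ≥ 1 for w ≤ 1/2 and Z ≥ 1.
The constant is that of `update_le`, so one number compares the two densities in both directions. -/
lemma le_update (hp : RatioBound p S Z) (hg : IsDensityOn μ S g) {w : ℝ} (hw : 0 ≤ w)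
    (hw1 : w ≤ 1 / 2) (y : χ) (θ : E) : g θ ≤ (1 + 2 * (w * Z y)) * update p μ g w y θ := by
  by_cases hθ : θ ∈ S
  · have h1 : (1 - w) * g θ ≤ update p μ g w y θ := by
      have := hp.pos y θ hθ
      have := hp.mix_pos hg y
      have := hg.nonneg θ
      unfold update
      have : 0 ≤ w * (p y θ * g θ / mix p μ g y) := by positivity
      linarith
    have h2 : 1 ≤ (1 + 2 * (w * Z y)) * (1 - w) := by
      nlinarith [mul_le_mul_of_nonneg_left (hp.one_le y) hw]
    have h3 : 0 ≤ 1 + 2 * (w * Z y) := by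
      have := mul_nonneg hw (hp.Z_pos y).le; linarith
    calc g θ ≤ (1 + 2 * (w * Z y)) * (1 - w) * g θ := le_mul_of_one_le_left (hg.nonneg θ) h2
      _ = (1 + 2 * (w * Z y)) * ((1 - w) * g θ) := by ring
      _ ≤ _ := mul_le_mul_of_nonneg_left h1 h3
  · simp [update, hg.support θ hθ]

/-- A cruder comparison valid up to w = 1; it keeps divergences finite during the early steps, when
the weights may exceed 1/2. -/
lemma le_mul_update (hp : RatioBound p S Z) (hg : IsDensityOn μ S g) {w : ℝ} (hw : 0 ≤ w)
    (hw1 : w ≤ 1) (y : χ) (θ : E) : g θ ≤ Z y * update p μ g w y θ := by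
  by_cases hθ : θ ∈ S
  · have h1 : 1 ≤ Z y * (p y θ / mix p μ g y) := by
      rw [← mul_div_assoc, le_div_iff₀ (hp.mix_pos hg y), one_mul]
      exact hp.mix_le hg y hθ
    rw [update_eq]
    have h2 : 1 ≤ Z y * (1 + w * (p y θ / mix p μ g y - 1)) := by
      nlinarith [hp.one_le y]
    nlinarith [hg.nonneg θ]
  · simp [update, hg.support θ hθ]

lemma mix_update (hp : RatioBound p S Z) (hg : IsDensityOn μ S g) (w : ℝ) (x y : χ) :
    mix p μ (update p μ g w y) x = mix p μ g x * (1 + w * (overlap p μ g x y - 1)) := by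
  have hx := (hp.mix_pos hg x).ne'
  have hy := (hp.mix_pos hg y).ne'
  have : mix p μ (update p μ g w y) x
      = (1 - w) * mix p μ g x + (w / mix p μ g y) * ∫ θ, p x θ * p y θ * g θ ∂μ := by
    conv_rhs => rw [mix]
    conv_lhs => rw [mix]
    rw [← integral_const_mul, ← integral_const_mul, ← integral_add
      ((hp.integrable hg x).const_mul _) ((hp.integrable_mul_mul hg x y).const_mul _)]
    congr 1 with θ
    unfold update; ring
  rw [this, overlap]
  field_simp
  ring

/-- Comparison of the marginals and overlaps of two comparable densities. -/
lemma mix_le_of_le (hp : RatioBound p S Z) (hg : IsDensityOn μ S g) (hh : IsDensityOn μ S h)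
    {c : ℝ} (hc : ∀ θ, g θ ≤ c * h θ) (x : χ) : mix p μ g x ≤ c * mix p μ h x := by
  rw [mix, mix, ← integral_const_mul]
  refine integral_mono (hp.integrable hg x) ((hp.integrable hh x).const_mul c) fun θ => ?_
  by_cases hθ : θ ∈ S
  · have := mul_le_mul_of_nonneg_left (hc θ) (hp.pos x θ hθ).le
    simp only; linarith
  · simp [hg.support θ hθ, hh.support θ hθ]

/-- One factor c comes from the numerator and one from each of the two marginals in the denominator.
-/
lemma overlap_le_of_le (hp : RatioBound p S Z) (hg : IsDensityOn μ S g) (hh : IsDensityOn μ S h)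
    {c : ℝ} (hc0 : 0 < c) (hgh : ∀ θ, g θ ≤ c * h θ) (hhg : ∀ θ, h θ ≤ c * g θ) (x y : χ) :
    overlap p μ g x y ≤ c ^ 3 * overlap p μ h x y := by
  have hgx := hp.mix_pos hg x
  have hgy := hp.mix_pos hg y
  have hhx := hp.mix_pos hh x
  have hhy := hp.mix_pos hh y
  have hN : ∫ θ, p x θ * p y θ * g θ ∂μ ≤ c * ∫ θ, p x θ * p y θ * h θ ∂μ := by
    rw [← integral_const_mul]
    refine integral_mono (hp.integrable_mul_mul hg x y)
      ((hp.integrable_mul_mul hh x y).const_mul c) fun θ => ?_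
    by_cases hθ : θ ∈ S
    · have := mul_le_mul_of_nonneg_left (hgh θ) (mul_pos (hp.pos x θ hθ) (hp.pos y θ hθ)).le
      simp only; linarith
    · simp [hg.support θ hθ, hh.support θ hθ]
  have hN0 : 0 ≤ ∫ θ, p x θ * p y θ * h θ ∂μ := by
    refine integral_nonneg fun θ => ?_
    by_cases hθ : θ ∈ S
    · exact mul_nonneg (mul_pos (hp.pos x θ hθ) (hp.pos y θ hθ)).le (hh.nonneg θ)
    · simp [hh.support θ hθ]
  have hmx := hp.mix_le_of_le hh hg hhg x
  have hmy := hp.mix_le_of_le hh hg hhg y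
  rw [overlap, overlap, ← mul_div_assoc, div_le_div_iff₀ (mul_pos hgx hgy) (mul_pos hhx hhy)]
  have hm : mix p μ h x * mix p μ h y ≤ c ^ 2 * (mix p μ g x * mix p μ g y) := by
    calc mix p μ h x * mix p μ h y ≤ (c * mix p μ g x) * (c * mix p μ g y) :=
          mul_le_mul hmx hmy hhy.le (by positivity)
      _ = _ := by ring
  calc (∫ θ, p x θ * p y θ * g θ ∂μ) * (mix p μ h x * mix p μ h y)
      ≤ (c * ∫ θ, p x θ * p y θ * h θ ∂μ) * (c ^ 2 * (mix p μ g x * mix p μ g y)) :=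
        mul_le_mul hN hm (by positivity) (by positivity)
    _ = _ := by ring

end RatioBound

end Densities

/-! ### Elementary bounds for the logarithm -/

lemma log_one_add_ge {t : ℝ} (ht : -(1 / 2) ≤ t) : t - 2 * t ^ 2 ≤ Real.log (1 + t) := by
  have h1 : 0 < 1 + t := by linarith
  have h2 := Real.one_sub_inv_le_log_of_pos h1
  have h3 : 1 - (1 + t)⁻¹ = t / (1 + t) := by field_simp; ring
  have h4 : t - 2 * t ^ 2 ≤ t / (1 + t) := by
    rw [le_div_iff₀ h1]; nlinarith [sq_nonneg t]
  linarith

/-- Second-order expansion shared by both Lyapunov functions: w ≤ 1/2 and r ≥ 0 keep w(r − 1) above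
−1/2, and 0 ≤ r ≤ Z with Z ≥ 1 gives (r − 1)² ≤ Z². -/
lemma log_step {w r Z : ℝ} (hw : 0 ≤ w) (hw1 : w ≤ 1 / 2) (hr : 0 ≤ r) (hrZ : r ≤ Z)
    (hZ : 1 ≤ Z) : w * (r - 1) - 2 * w ^ 2 * Z ^ 2 ≤ Real.log (1 + w * (r - 1)) := by
  have h1 : -(1 / 2) ≤ w * (r - 1) := by nlinarith
  have h2 := log_one_add_ge h1
  have h3 : (r - 1) ^ 2 ≤ Z ^ 2 := by nlinarith
  nlinarith [mul_le_mul_of_nonneg_left h3 (sq_nonneg w)]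

lemma abs_log_le {r Z : ℝ} (hr : 0 < r) (h1 : r ≤ Z) (h2 : 1 ≤ Z * r) : |Real.log r| ≤ Z := by
  have hZ : 0 < Z := hr.trans_le h1
  rw [abs_le]
  constructor
  · have := Real.one_sub_inv_le_log_of_pos hr
    have : r⁻¹ ≤ Z := by rw [inv_le_iff_one_le_mul₀ hr]; exact h2
    linarith
  · have := Real.log_le_sub_one_of_pos hr
    linarith

/-! ### Drift of the excess divergence -/

section Drift

variable {χ E : Type*} [MeasurableSpace χ] [MeasurableSpace E]

/-- The mean of `log (m_h / m_g)` under `Q`. -/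
noncomputable def logRatio (p : χ → E → ℝ) (μ : Measure E) (Q : Measure χ) (h g : E → ℝ) : ℝ :=
  ∫ x, Real.log (mix p μ h x / mix p μ g x) ∂Q

/-- The relative excess `m_h / m_g - 1` of the marginal densities. -/
noncomputable def excess (p : χ → E → ℝ) (μ : Measure E) (h g : E → ℝ) (x : χ) : ℝ :=
  mix p μ h x / mix p μ g x - 1

/-- The mean excess of the overlap under `Q`. -/
noncomputable def overlapExcess (p : χ → E → ℝ) (μ : Measure E) (Q : Measure χ) (g : E → ℝ)
    (y : χ) : ℝ :=
  ∫ x, overlap p μ g x y ∂Q - 1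

variable {μ : Measure E} {S : Set E} {p : χ → E → ℝ} {Z : χ → ℝ} {g h k : E → ℝ} {Q : Measure χ}

namespace RatioBound

lemma mix_div_pos (hp : RatioBound p S Z) (hg : IsDensityOn μ S g) (hh : IsDensityOn μ S h)
    (x : χ) : 0 < mix p μ h x / mix p μ g x := div_pos (hp.mix_pos hh x) (hp.mix_pos hg x)

lemma mix_div_le (hp : RatioBound p S Z) (hg : IsDensityOn μ S g) (hh : IsDensityOn μ S h)
    (x : χ) : mix p μ h x / mix p μ g x ≤ Z x := by
  rw [div_le_iff₀ (hp.mix_pos hg x)]; exact hp.mix_le_mix hg hh x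

lemma one_le_mul_mix_div (hp : RatioBound p S Z) (hg : IsDensityOn μ S g)
    (hh : IsDensityOn μ S h) (x : χ) : 1 ≤ Z x * (mix p μ h x / mix p μ g x) := by
  rw [← mul_div_assoc, le_div_iff₀ (hp.mix_pos hg x), one_mul]; exact hp.mix_le_mix hh hg x

lemma abs_log_mix_div_le (hp : RatioBound p S Z) (hg : IsDensityOn μ S g)
    (hh : IsDensityOn μ S h) (x : χ) : |Real.log (mix p μ h x / mix p μ g x)| ≤ Z x :=
  abs_log_le (hp.mix_div_pos hg hh x) (hp.mix_div_le hg hh x) (hp.one_le_mul_mix_div hg hh x)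

variable [SFinite μ]

lemma integrable_log (hp : RatioBound p S Z) (hZ : Integrable Z Q) (hg : IsDensityOn μ S g)
    (hh : IsDensityOn μ S h) :
    Integrable (fun x => Real.log (mix p μ h x / mix p μ g x)) Q :=
  hZ.mono' ((hp.measurable_mix hh.measurable).div
    (hp.measurable_mix hg.measurable)).log.aestronglyMeasurable
    (Eventually.of_forall fun x => hp.abs_log_mix_div_le hg hh x)

/-- Every log ratio is dominated by Z, hence integrable, so mean log ratios satisfy the cocycle
identity. With k the true density it rewrites a difference of two divergences as one integral. -/
lemma logRatio_sub (hp : RatioBound p S Z) (hZ : Integrable Z Q) (hg : IsDensityOn μ S g)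
    (hh : IsDensityOn μ S h) (hk : IsDensityOn μ S k) :
    logRatio p μ Q k g - logRatio p μ Q k h = logRatio p μ Q h g := by
  rw [logRatio, logRatio, ← integral_sub (hp.integrable_log hZ hg hk) (hp.integrable_log hZ hh hk),
    logRatio]
  congr 1 with x
  rw [Real.log_div (hp.mix_pos hk x).ne' (hp.mix_pos hg x).ne',
    Real.log_div (hp.mix_pos hk x).ne' (hp.mix_pos hh x).ne',
    Real.log_div (hp.mix_pos hh x).ne' (hp.mix_pos hg x).ne']
  ring

omit [SFinite μ] in
lemma abs_excess_le (hp : RatioBound p S Z) (hg : IsDensityOn μ S g) (hh : IsDensityOn μ S h)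
    (x : χ) : |excess p μ h g x| ≤ Z x := by
  have h1 := hp.mix_div_pos hg hh x
  have h2 := hp.mix_div_le hg hh x
  have h3 := hp.one_le x
  rw [excess, abs_le]; constructor <;> linarith

lemma measurable_excess (hp : RatioBound p S Z) (hg : IsDensityOn μ S g)
    (hh : IsDensityOn μ S h) : Measurable (excess p μ h g) :=
  ((hp.measurable_mix hh.measurable).div (hp.measurable_mix hg.measurable)).sub_const 1

lemma logRatio_le_integral_excess (hp : RatioBound p S Z) (hZ : Integrable Z Q)
    (hg : IsDensityOn μ S g) (hh : IsDensityOn μ S h) :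
    logRatio p μ Q h g ≤ ∫ x, excess p μ h g x ∂Q := by
  refine integral_mono (hp.integrable_log hZ hg hh)
    (hZ.mono' (hp.measurable_excess hg hh).aestronglyMeasurable
      (Eventually.of_forall fun x => hp.abs_excess_le hg hh x)) fun x => ?_
  exact Real.log_le_sub_one_of_pos (hp.mix_div_pos hg hh x)

omit [SFinite μ] in
-- The factor c alone would do; the cube gives the same form as `abs_overlapExcess_sub_le`, so that
-- `lagged_step` serves both drifts.
lemma abs_excess_sub_le (hp : RatioBound p S Z) (hg : IsDensityOn μ S g)
    (hh : IsDensityOn μ S h) (hk : IsDensityOn μ S k) {c : ℝ} (hc : 1 ≤ c)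
    (hgh : ∀ θ, g θ ≤ c * h θ) (hhg : ∀ θ, h θ ≤ c * g θ) (x : χ) :
    |excess p μ k g x - excess p μ k h x| ≤ (c ^ 3 - 1) * Z x := by
  have hc3 : c ≤ c ^ 3 := le_self_pow₀ hc (by norm_num)
  have key : ∀ {g h : E → ℝ}, IsDensityOn μ S g → IsDensityOn μ S h → (∀ θ, h θ ≤ c * g θ) →
      mix p μ k x / mix p μ g x - mix p μ k x / mix p μ h x ≤ (c ^ 3 - 1) * Z x := by
    intro g h hg hh hhg
    have h1 : mix p μ k x / mix p μ g x ≤ c * (mix p μ k x / mix p μ h x) := by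
      rw [← mul_div_assoc, div_le_div_iff₀ (hp.mix_pos hg x) (hp.mix_pos hh x)]
      have := mul_le_mul_of_nonneg_left (hp.mix_le_of_le hh hg hhg x) (hp.mix_pos hk x).le
      linarith
    have h2 := hp.mix_div_le hh hk x
    have h3 := hp.mix_div_pos hh hk x
    nlinarith [hp.Z_pos x]
  have h1 := key hg hh hhg
  have h2 := key hh hg hgh
  rw [excess, excess, abs_le]; constructor <;> linarith

lemma measurable_overlap (hp : RatioBound p S Z) (hg : Measurable g) :
    Measurable (Function.uncurry (overlap p μ g)) := by
  have hm := hp.measurable_mix (μ := μ) hg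
  refine Measurable.div ?_ ((hm.comp measurable_fst).mul (hm.comp measurable_snd))
  refine (StronglyMeasurable.integral_prod_right
    (f := fun (z : χ × χ) θ => p z.1 θ * p z.2 θ * g θ) ?_).measurable
  have h1 : Measurable fun z : (χ × χ) × E => p z.1.1 z.2 :=
    hp.meas.comp (measurable_fst.fst.prodMk measurable_snd)
  have h2 : Measurable fun z : (χ × χ) × E => p z.1.2 z.2 :=
    hp.meas.comp (measurable_fst.snd.prodMk measurable_snd)
  exact ((h1.mul h2).mul (hg.comp measurable_snd)).stronglyMeasurable

lemma integrable_overlap [IsProbabilityMeasure Q] (hp : RatioBound p S Z)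
    (hg : IsDensityOn μ S g) (y : χ) : Integrable (fun x => overlap p μ g x y) Q := by
  refine (integrable_const (Z y)).mono' ((hp.measurable_overlap hg.measurable).comp
    measurable_prodMk_right).aestronglyMeasurable (Eventually.of_forall fun x => ?_)
  rw [Real.norm_eq_abs, abs_of_nonneg (hp.overlap_nonneg hg x y)]
  exact hp.overlap_le hg x y

lemma integral_overlap_le [IsProbabilityMeasure Q] (hp : RatioBound p S Z)
    (hg : IsDensityOn μ S g) (y : χ) : ∫ x, overlap p μ g x y ∂Q ≤ Z y := by
  have := integral_mono (hp.integrable_overlap (Q := Q) hg y) (integrable_const (Z y))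
    fun x => hp.overlap_le hg x y
  simpa using this

omit [SFinite μ] in
lemma integral_overlap_nonneg (hp : RatioBound p S Z)
    (hg : IsDensityOn μ S g) (y : χ) : 0 ≤ ∫ x, overlap p μ g x y ∂Q :=
  integral_nonneg fun x => hp.overlap_nonneg hg x y

lemma abs_overlapExcess_le [IsProbabilityMeasure Q] (hp : RatioBound p S Z)
    (hg : IsDensityOn μ S g) (y : χ) : |overlapExcess p μ Q g y| ≤ Z y := by
  have h1 := hp.integral_overlap_nonneg (Q := Q) hg y
  have h2 := hp.integral_overlap_le (Q := Q) hg y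
  have h3 := hp.one_le y
  rw [overlapExcess, abs_le]; constructor <;> linarith

lemma abs_overlapExcess_sub_le [IsProbabilityMeasure Q] (hp : RatioBound p S Z)
    (hg : IsDensityOn μ S g) (hh : IsDensityOn μ S h) {c : ℝ} (hc : 1 ≤ c)
    (hgh : ∀ θ, g θ ≤ c * h θ) (hhg : ∀ θ, h θ ≤ c * g θ) (y : χ) :
    |overlapExcess p μ Q g y - overlapExcess p μ Q h y| ≤ (c ^ 3 - 1) * Z y := by
  have hc3 : 1 ≤ c ^ 3 := one_le_pow₀ hc
  have key : ∀ {g h : E → ℝ}, IsDensityOn μ S g → IsDensityOn μ S h → (∀ θ, g θ ≤ c * h θ) →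
      (∀ θ, h θ ≤ c * g θ) →
      ∫ x, overlap p μ g x y ∂Q - ∫ x, overlap p μ h x y ∂Q ≤ (c ^ 3 - 1) * Z y := by
    intro g h hg hh hgh hhg
    have h1 : ∫ x, overlap p μ g x y ∂Q ≤ c ^ 3 * ∫ x, overlap p μ h x y ∂Q := by
      rw [← integral_const_mul]
      exact integral_mono (hp.integrable_overlap hg y) ((hp.integrable_overlap hh y).const_mul _)
        fun x => hp.overlap_le_of_le hg hh (by linarith) hgh hhg x y
    have h2 := hp.integral_overlap_le (Q := Q) hh y
    have h3 := hp.integral_overlap_nonneg (Q := Q) hh y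
    nlinarith [hp.Z_pos y]
  have h1 := key hg hh hgh hhg
  have h2 := key hh hg hhg hgh
  rw [overlapExcess, overlapExcess, abs_le]; constructor <;> linarith

lemma measurable_overlapExcess [SFinite Q] (hp : RatioBound p S Z) (hg : Measurable g) :
    Measurable (overlapExcess p μ Q g) := by
  have : Measurable fun y => ∫ x, overlap p μ g x y ∂Q :=
    (StronglyMeasurable.integral_prod_left (f := fun x y => overlap p μ g x y)
      (hp.measurable_overlap hg).stronglyMeasurable).measurable
  exact this.sub_const 1

omit [SFinite μ] in
lemma ofReal_mix (hp : RatioBound p S Z) (hg : IsDensityOn μ S g) (x : χ) :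
    ENNReal.ofReal (mix p μ g x) = ∫⁻ θ, ENNReal.ofReal (p x θ) * ENNReal.ofReal (g θ) ∂μ := by
  rw [mix, ofReal_integral_eq_lintegral_ofReal (hp.integrable hg x)]
  · congr 1 with θ
    rw [ENNReal.ofReal_mul' (hg.nonneg θ)]
  · refine Eventually.of_forall fun θ => ?_
    by_cases hθ : θ ∈ S
    · exact mul_nonneg (hp.pos x θ hθ).le (hg.nonneg θ)
    · simp [hg.support θ hθ]

omit [SFinite μ] in
lemma ofReal_overlap (hp : RatioBound p S Z) (hg : IsDensityOn μ S g) (x y : χ) :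
    ENNReal.ofReal (overlap p μ g x y) =
      ∫⁻ θ, ENNReal.ofReal (p x θ / mix p μ g x) * ENNReal.ofReal (p y θ / mix p μ g y)
        * ENNReal.ofReal (g θ) ∂μ := by
  have hx := hp.mix_pos hg x
  have hy := hp.mix_pos hg y
  rw [overlap, ← integral_div,
    ofReal_integral_eq_lintegral_ofReal ((hp.integrable_mul_mul hg x y).div_const _)]
  · congr 1 with θ
    by_cases hθ : θ ∈ S
    · have h1 := hp.pos x θ hθ
      have h2 := hp.pos y θ hθ
      rw [← ENNReal.ofReal_mul (by positivity), ← ENNReal.ofReal_mul (by positivity)]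
      congr 1
      field_simp
    · simp [hg.support θ hθ]
  · refine Eventually.of_forall fun θ => div_nonneg ?_ (by positivity)
    by_cases hθ : θ ∈ S
    · exact mul_nonneg (mul_pos (hp.pos x θ hθ) (hp.pos y θ hθ)).le (hg.nonneg θ)
    · simp [hg.support θ hθ]

/-- By Tonelli the double integral is ∫ φ² g dμ with φ(θ) = ∫ p(x|θ)/m_g(x) Q(dx), while ∫ φ g dμ =
1. So the claim is that a second moment dominates the squared mean. Extended nonnegative integrals
are used because φ may be infinite. -/
lemma one_le_lintegral_overlap [IsProbabilityMeasure Q] (hp : RatioBound p S Z)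
    (hg : IsDensityOn μ S g) :
    1 ≤ ∫⁻ y, ∫⁻ x, ENNReal.ofReal (overlap p μ g x y) ∂Q ∂Q := by
  have hm := hp.measurable_mix (μ := μ) hg.measurable
  set ψ : χ → E → ℝ≥0∞ := fun x θ => ENNReal.ofReal (p x θ / mix p μ g x)
  have hψ : Measurable (Function.uncurry ψ) :=
    (hp.meas.div (hm.comp measurable_fst)).ennreal_ofReal
  have hg' : Measurable fun θ => ENNReal.ofReal (g θ) := hg.measurable.ennreal_ofReal
  set φ : E → ℝ≥0∞ := fun θ => ∫⁻ x, ψ x θ ∂Q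
  have hφ : Measurable φ := Measurable.lintegral_prod_left hψ
  have hψx : ∀ x, Measurable (ψ x) := fun x => hψ.comp measurable_prodMk_left
  have hψθ : ∀ θ, Measurable fun x => ψ x θ := fun θ => hψ.comp measurable_prodMk_right
  have e1 : ∫⁻ y, ∫⁻ x, ENNReal.ofReal (overlap p μ g x y) ∂Q ∂Q
      = ∫⁻ θ, φ θ * φ θ * ENNReal.ofReal (g θ) ∂μ := by
    have : ∀ y, ∫⁻ x, ENNReal.ofReal (overlap p μ g x y) ∂Q
        = ∫⁻ θ, φ θ * (ψ y θ * ENNReal.ofReal (g θ)) ∂μ := by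
      intro y
      simp_rw [hp.ofReal_overlap hg]
      rw [lintegral_lintegral_swap]
      · congr 1 with θ
        simp_rw [mul_assoc]
        rw [lintegral_mul_const _ (hψθ θ)]
      · exact ((hψ.mul ((hψx y).comp measurable_snd)).mul
          (hg'.comp measurable_snd)).aemeasurable
    simp_rw [this]
    rw [lintegral_lintegral_swap]
    · congr 1 with θ
      rw [lintegral_const_mul _ ((hψθ θ).mul_const _), lintegral_mul_const _ (hψθ θ), mul_assoc]
    · exact ((hφ.comp measurable_snd).mul (hψ.mul (hg'.comp measurable_snd))).aemeasurable
  have e2 : ∫⁻ θ, φ θ * ENNReal.ofReal (g θ) ∂μ = 1 := by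
    have : ∀ θ, φ θ * ENNReal.ofReal (g θ) = ∫⁻ x, ψ x θ * ENNReal.ofReal (g θ) ∂Q :=
      fun θ => (lintegral_mul_const _ (hψθ θ)).symm
    simp_rw [this]
    rw [lintegral_lintegral_swap]
    · have : ∀ x, ∫⁻ θ, ψ x θ * ENNReal.ofReal (g θ) ∂μ = 1 := by
        intro x
        have hx := hp.mix_pos hg x
        have h1 := hp.ofReal_mix hg x
        have h2 : ∀ θ, ψ x θ * ENNReal.ofReal (g θ)
            = ENNReal.ofReal (mix p μ g x)⁻¹ * (ENNReal.ofReal (p x θ) * ENNReal.ofReal (g θ)) := by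
          intro θ
          simp only [ψ]
          rw [div_eq_inv_mul, ENNReal.ofReal_mul (by positivity), mul_assoc]
        simp_rw [h2]
        rw [lintegral_const_mul _ ((hp.measurable_right x).ennreal_ofReal.fun_mul hg'), ← h1,
          ← ENNReal.ofReal_mul (by positivity), inv_mul_cancel₀ hx.ne', ENNReal.ofReal_one]
      simp [this]
    · exact (hψ.comp measurable_swap).mul (hg'.comp measurable_fst) |>.aemeasurable
  rw [e1]
  -- Integrate 2φ ≤ 1 + φ² against g. The summand 1 stays on the right, since subtraction in `ℝ≥0∞`
  -- is truncated, and is cancelled at the end.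
  have h2 : (2 : ℝ≥0∞) ≤ 1 + ∫⁻ θ, φ θ * φ θ * ENNReal.ofReal (g θ) ∂μ := by
    calc (2 : ℝ≥0∞) = ∫⁻ θ, 2 * (φ θ * ENNReal.ofReal (g θ)) ∂μ := by
          rw [lintegral_const_mul _ (hφ.fun_mul hg'), e2, mul_one]
      _ ≤ ∫⁻ θ, (ENNReal.ofReal (g θ) + φ θ * φ θ * ENNReal.ofReal (g θ)) ∂μ := by
          refine lintegral_mono fun θ => ?_
          have : 2 * φ θ ≤ 1 + φ θ * φ θ := by
            rcases eq_or_ne (φ θ) ⊤ with h | h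
            · simp [h]
            · lift φ θ to NNReal using h with t
              norm_cast
              rw [← NNReal.coe_le_coe]
              push_cast
              nlinarith [sq_nonneg ((t : ℝ) - 1)]
          calc 2 * (φ θ * ENNReal.ofReal (g θ)) = (2 * φ θ) * ENNReal.ofReal (g θ) := by ring
            _ ≤ (1 + φ θ * φ θ) * ENNReal.ofReal (g θ) := by gcongr
            _ = _ := by ring
      _ = _ := by rw [lintegral_add_left hg', hg.total]
  have h3 : (1 : ℝ≥0∞) + 1 ≤ 1 + ∫⁻ θ, φ θ * φ θ * ENNReal.ofReal (g θ) ∂μ := by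
    rw [one_add_one_eq_two]; exact h2
  exact (ENNReal.add_le_add_iff_left ENNReal.one_ne_top).1 h3

lemma integral_overlapExcess_nonneg [IsProbabilityMeasure Q] (hp : RatioBound p S Z)
    (hZ : Integrable Z Q) (hg : IsDensityOn μ S g) : 0 ≤ ∫ y, overlapExcess p μ Q g y ∂Q := by
  have hmeas := hp.measurable_overlapExcess (μ := μ) (Q := Q) hg.measurable
  have hi : Integrable (fun y => ∫ x, overlap p μ g x y ∂Q) Q := by
    refine hZ.mono' ?_ (Eventually.of_forall fun y => ?_)
    · have := (hmeas.add_const 1).aestronglyMeasurable (μ := Q)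
      simpa [overlapExcess] using this
    · rw [Real.norm_eq_abs, abs_of_nonneg (hp.integral_overlap_nonneg hg y)]
      exact hp.integral_overlap_le hg y
  have h1 : 1 ≤ ∫ y, ∫ x, overlap p μ g x y ∂Q ∂Q := by
    rw [← ENNReal.one_le_ofReal, ofReal_integral_eq_lintegral_ofReal hi
      (Eventually.of_forall fun y => hp.integral_overlap_nonneg hg y)]
    refine (hp.one_le_lintegral_overlap (Q := Q) hg).trans (lintegral_mono fun y => ?_)
    rw [ofReal_integral_eq_lintegral_ofReal (hp.integrable_overlap hg y)
      (Eventually.of_forall fun x => hp.overlap_nonneg hg x y)]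
  unfold overlapExcess
  rw [integral_sub hi (integrable_const 1)]
  simpa using h1

/-- The new marginal is the old one times 1 + w(overlap − 1); averaging `log_step` over x gives the
drift, with a remainder depending only on the observation y. -/
lemma logRatio_update_le [IsProbabilityMeasure Q] (hp : RatioBound p S Z) (hZ : Integrable Z Q)
    (hg : IsDensityOn μ S g) (hh : IsDensityOn μ S h) {w : ℝ} (hw : 0 ≤ w) (hw1 : w ≤ 1 / 2)
    (y : χ) : logRatio p μ Q h (update p μ g w y) ≤
      logRatio p μ Q h g - w * overlapExcess p μ Q g y + 2 * w ^ 2 * Z y ^ 2 := by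
  have hu := hp.isDensityOn_update hg hw (by linarith) y
  rw [← sub_le_iff_le_add, ← neg_le_neg_iff]
  have h1 := hp.logRatio_sub hZ hg hu hh
  have h2 : w * overlapExcess p μ Q g y - 2 * w ^ 2 * Z y ^ 2
      ≤ logRatio p μ Q (update p μ g w y) g := by
    have h3 : Integrable (fun x => w * (overlap p μ g x y - 1)) Q :=
      ((hp.integrable_overlap hg y).sub (integrable_const 1)).const_mul w
    have hi : Integrable (fun x => w * (overlap p μ g x y - 1) - 2 * w ^ 2 * Z y ^ 2) Q :=
      h3.sub (integrable_const _)
    have e : w * overlapExcess p μ Q g y - 2 * w ^ 2 * Z y ^ 2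
        = ∫ x, (w * (overlap p μ g x y - 1) - 2 * w ^ 2 * Z y ^ 2) ∂Q := by
      rw [integral_sub h3 (integrable_const _), integral_const_mul,
        integral_sub (hp.integrable_overlap hg y) (integrable_const _), overlapExcess]
      simp
    rw [e]
    refine integral_mono hi (hp.integrable_log hZ hg hu) fun x => ?_
    simp only
    rw [hp.mix_update hg, mul_div_cancel_left₀ _ (hp.mix_pos hg x).ne']
    exact log_step hw hw1 (hp.overlap_nonneg hg x y) (hp.overlap_le hg x y) (hp.one_le y)
  linarith

end RatioBound

end Drift

/-! ### Kullback–Leibler divergence as an integral of log ratios -/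

section Entropy

variable {α : Type*} [MeasurableSpace α] {ρ : Measure α} {g h : α → ℝ} {S T : Set α}

/-- The measure with density `g`. -/
noncomputable def dens (ρ : Measure α) (g : α → ℝ) : Measure α :=
  ρ.withDensity fun x => ENNReal.ofReal (g x)

namespace IsDensityOn

lemma isProbabilityMeasure (hg : IsDensityOn ρ S g) : IsProbabilityMeasure (dens ρ g) :=
  ⟨by rw [dens, withDensity_apply _ MeasurableSet.univ, Measure.restrict_univ, hg.total]⟩

lemma ae_dens_iff (hg : IsDensityOn ρ S g) {s : α → Prop} :
    (∀ᵐ x ∂dens ρ g, s x) ↔ ∀ᵐ x ∂ρ, 0 < g x → s x := by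
  rw [dens, ae_withDensity_iff' hg.measurable.ennreal_ofReal.aemeasurable]
  simp

lemma ae_pos (hg : IsDensityOn ρ S g) : ∀ᵐ x ∂dens ρ g, 0 < g x :=
  hg.ae_dens_iff.2 (Eventually.of_forall fun _ h => h)

lemma ae_mem (hg : IsDensityOn ρ S g) : ∀ᵐ x ∂dens ρ g, x ∈ S :=
  hg.ae_dens_iff.2 (Eventually.of_forall fun x hx => by
    by_contra hS; exact hx.ne' (hg.support x hS))

lemma integral_dens (hg : IsDensityOn ρ S g) (φ : α → ℝ) :
    ∫ x, φ x ∂dens ρ g = ∫ x, φ x * g x ∂ρ := by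
  have h := integral_withDensity_eq_integral_toReal_smul (μ := ρ)
    hg.measurable.ennreal_ofReal (Eventually.of_forall fun _ => ENNReal.ofReal_lt_top) φ
  rw [dens, h]
  congr 1 with x
  rw [ENNReal.toReal_ofReal (hg.nonneg x), smul_eq_mul, mul_comm]

lemma integrable_dens_iff (hg : IsDensityOn ρ S g) {φ : α → ℝ} :
    Integrable φ (dens ρ g) ↔ Integrable (fun x => φ x * g x) ρ := by
  rw [dens, integrable_withDensity_iff hg.measurable.ennreal_ofReal
    (Eventually.of_forall fun _ => ENNReal.ofReal_lt_top)]
  simp_rw [ENNReal.toReal_ofReal (hg.nonneg _)]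

lemma dens_eq_withDensity (hg : IsDensityOn ρ S g) (hh : IsDensityOn ρ T h)
    (hpos : ∀ᵐ x ∂dens ρ g, 0 < h x) :
    dens ρ g = (dens ρ h).withDensity fun x => ENNReal.ofReal (g x / h x) := by
  rw [dens, dens, ← withDensity_mul _ hh.measurable.ennreal_ofReal
    (hg.measurable.fun_div hh.measurable).ennreal_ofReal]
  refine withDensity_congr_ae ?_
  filter_upwards [hg.ae_dens_iff.1 hpos] with x hx
  rw [Pi.mul_apply, ← ENNReal.ofReal_mul (hh.nonneg x)]
  rcases (hg.nonneg x).eq_or_lt with h0 | h0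
  · simp [← h0]
  · rw [mul_div_cancel₀ _ (hx h0).ne']

lemma absolutelyContinuous (hg : IsDensityOn ρ S g) (hh : IsDensityOn ρ T h)
    (hpos : ∀ᵐ x ∂dens ρ g, 0 < h x) : dens ρ g ≪ dens ρ h := by
  rw [hg.dens_eq_withDensity hh hpos]
  exact withDensity_absolutelyContinuous _ _

lemma llr_ae_eq (hg : IsDensityOn ρ S g) (hh : IsDensityOn ρ T h)
    (hpos : ∀ᵐ x ∂dens ρ g, 0 < h x) :
    llr (dens ρ g) (dens ρ h) =ᵐ[dens ρ g] fun x => Real.log (g x / h x) := by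
  have := hh.isProbabilityMeasure
  have h1 : (dens ρ g).rnDeriv (dens ρ h) =ᵐ[dens ρ h] fun x => ENNReal.ofReal (g x / h x) := by
    conv_lhs => rw [hg.dens_eq_withDensity hh hpos]
    exact Measure.rnDeriv_withDensity _ (hg.measurable.div hh.measurable).ennreal_ofReal
  filter_upwards [(hg.absolutelyContinuous hh hpos).ae_le h1] with x hx
  rw [llr, hx, ENNReal.toReal_ofReal (div_nonneg (hg.nonneg x) (hh.nonneg x))]

lemma KL_ne_top (hg : IsDensityOn ρ S g) (hh : IsDensityOn ρ T h)
    (hpos : ∀ᵐ x ∂dens ρ g, 0 < h x)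
    (hi : Integrable (fun x => Real.log (g x / h x)) (dens ρ g)) : KL ρ g h ≠ ⊤ :=
  InformationTheory.klDiv_ne_top (hg.absolutelyContinuous hh hpos)
    (hi.congr (hg.llr_ae_eq hh hpos).symm)

/-- Both measures have mass one, so the mass correction contained in `klDiv` cancels. -/
lemma toReal_KL (hg : IsDensityOn ρ S g) (hh : IsDensityOn ρ T h)
    (hpos : ∀ᵐ x ∂dens ρ g, 0 < h x) :
    (KL ρ g h).toReal = ∫ x, Real.log (g x / h x) ∂dens ρ g := by
  have := hg.isProbabilityMeasure
  have := hh.isProbabilityMeasure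
  rw [← integral_congr_ae (hg.llr_ae_eq hh hpos)]
  exact InformationTheory.toReal_klDiv_of_measure_eq (μ := dens ρ g) (ν := dens ρ h)
    (hg.absolutelyContinuous hh hpos) (by simp)

lemma of_KL_ne_top (hg : IsDensityOn ρ S g) (hh : IsDensityOn ρ T h) (hKL : KL ρ g h ≠ ⊤) :
    (∀ᵐ x ∂dens ρ g, 0 < h x) ∧ Integrable (fun x => Real.log (g x / h x)) (dens ρ g) := by
  obtain ⟨h1, h2⟩ := InformationTheory.klDiv_ne_top_iff.1 hKL
  have hpos : ∀ᵐ x ∂dens ρ g, 0 < h x := h1.ae_le hh.ae_pos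
  exact ⟨hpos, h2.congr (hg.llr_ae_eq hh hpos)⟩

end IsDensityOn

end Entropy

/-! ### Entropy step, optimality of the projection, Hellinger bound -/

section Steps

variable {χ E : Type*} [MeasurableSpace χ] [MeasurableSpace E]
  {μ : Measure E} {S : Set E} {p : χ → E → ℝ} {Z : χ → ℝ} {g h k f : E → ℝ} {Q : Measure χ}

namespace RatioBound

lemma isDensityOn_mix [SFinite μ] {ν : Measure χ} [SFinite ν] (hp : RatioBound p S Z)
    (hp1 : ∀ θ ∈ S, ∫⁻ x, ENNReal.ofReal (p x θ) ∂ν = 1) (hg : IsDensityOn μ S g) :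
    IsDensityOn ν Set.univ (mix p μ g) := by
  refine ⟨hp.measurable_mix hg.measurable, fun x => (hp.mix_pos hg x).le, by simp, ?_⟩
  simp_rw [hp.ofReal_mix hg]
  rw [lintegral_lintegral_swap]
  · rw [← hg.total]
    congr 1 with θ
    rw [lintegral_mul_const _ (hp.measurable_left θ).ennreal_ofReal]
    by_cases hθ : θ ∈ S
    · rw [hp1 θ hθ, one_mul]
    · simp [hg.support θ hθ]
  · exact (hp.meas.ennreal_ofReal.mul
      (hg.measurable.ennreal_ofReal.comp measurable_snd)).aemeasurable

/-- The Kullback–Leibler divergence of two mixtures is a finite mean log ratio. -/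
lemma KL_mix [SFinite μ] {ν : Measure χ} [SFinite ν] (hp : RatioBound p S Z)
    (hp1 : ∀ θ ∈ S, ∫⁻ x, ENNReal.ofReal (p x θ) ∂ν = 1) (hf : IsDensityOn μ S f)
    (hZ : Integrable Z (dens ν (mix p μ f))) (hg : IsDensityOn μ S g) :
    KL ν (mix p μ f) (mix p μ g) ≠ ⊤ ∧
      (KL ν (mix p μ f) (mix p μ g)).toReal = logRatio p μ (dens ν (mix p μ f)) f g := by
  have h1 := hp.isDensityOn_mix hp1 hf
  have h2 := hp.isDensityOn_mix hp1 hg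
  have hpos : ∀ᵐ x ∂dens ν (mix p μ f), 0 < mix p μ g x :=
    Eventually.of_forall (hp.mix_pos hg)
  exact ⟨h1.KL_ne_top h2 hpos (hp.integrable_log hZ hg hf), h1.toReal_KL h2 hpos⟩

/-- One step of the recursion decreases the divergence from `h`, up to a second-order term. -/
lemma entropy_update (hp : RatioBound p S Z) (hg : IsDensityOn μ S g) (hh : IsDensityOn μ S h)
    (hKL : KL μ h g ≠ ⊤) {w : ℝ} (hw : 0 ≤ w) (hw1 : w ≤ 1) (y : χ) :
    KL μ h (update p μ g w y) ≠ ⊤ ∧ (w ≤ 1 / 2 → (KL μ h (update p μ g w y)).toReal ≤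
      (KL μ h g).toReal - w * excess p μ h g y + 2 * w ^ 2 * Z y ^ 2) := by
  have hu := hp.isDensityOn_update hg hw hw1 y
  have hprob := hh.isProbabilityMeasure
  obtain ⟨hpos, hi⟩ := hh.of_KL_ne_top hg hKL
  have hmy := hp.mix_pos hg y
  have hZy := hp.Z_pos y
  -- The factor by which y reweights the density lies between 1/Z y and Z y, so its logarithm is
  -- bounded. Thus finiteness survives every step with w ≤ 1; only the quantitative bound needs w ≤
  -- 1/2.
  have hratio : ∀ᵐ θ ∂dens μ h, 0 < 1 + w * (p y θ / mix p μ g y - 1) ∧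
      1 + w * (p y θ / mix p μ g y - 1) ≤ Z y ∧
      1 ≤ Z y * (1 + w * (p y θ / mix p μ g y - 1)) ∧ 0 < p y θ / mix p μ g y ∧
      p y θ / mix p μ g y ≤ Z y := by
    filter_upwards [hh.ae_mem, hpos] with θ hθ hgθ
    have h0 := hp.div_mix_le hg y hθ
    have h1 := hp.one_le y
    have h3 := div_pos (hp.pos y θ hθ) hmy
    have h4 : 1 ≤ Z y * (1 + w * (p y θ / mix p μ g y - 1)) := by
      have := hp.le_mul_update hg hw hw1 y θ
      rw [update_eq] at this
      nlinarith
    exact ⟨pos_of_mul_pos_right (one_pos.trans_le h4) hZy.le, by nlinarith, h4, h3, h0⟩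
  have hpos' : ∀ᵐ θ ∂dens μ h, 0 < update p μ g w y θ := by
    filter_upwards [hratio, hpos] with θ h1 h2
    rw [update_eq]
    exact mul_pos h2 h1.1
  have hmeas : Measurable fun θ => Real.log (1 + w * (p y θ / mix p μ g y - 1)) :=
    (((((hp.measurable_right y).div_const _).sub_const 1).const_mul w).const_add 1).log
  have hli : Integrable (fun θ => Real.log (1 + w * (p y θ / mix p μ g y - 1))) (dens μ h) := by
    refine (integrable_const (Z y)).mono' hmeas.aestronglyMeasurable ?_
    filter_upwards [hratio] with θ h1
    exact abs_log_le h1.1 h1.2.1 h1.2.2.1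
  have hsplit : (fun θ => Real.log (h θ / update p μ g w y θ)) =ᵐ[dens μ h] fun θ =>
      Real.log (h θ / g θ) - Real.log (1 + w * (p y θ / mix p μ g y - 1)) := by
    filter_upwards [hratio, hpos, hh.ae_pos] with θ h1 h2 h3
    rw [update_eq, Real.log_div h3.ne' (mul_pos h2 h1.1).ne', Real.log_mul h2.ne' h1.1.ne',
      Real.log_div h3.ne' h2.ne']
    ring
  refine ⟨hh.KL_ne_top hu hpos' ((hi.sub hli).congr hsplit.symm), fun hw2 => ?_⟩
  rw [hh.toReal_KL hu hpos', hh.toReal_KL hg hpos, integral_congr_ae hsplit, integral_sub hi hli]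
  have hpi : Integrable (fun θ => p y θ / mix p μ g y) (dens μ h) :=
    (hh.integrable_dens_iff.2 (hp.integrable hh y)).div_const _
  have h3 : Integrable (fun θ => w * (p y θ / mix p μ g y - 1)) (dens μ h) :=
    (hpi.sub (integrable_const 1)).const_mul w
  have key : w * excess p μ h g y - 2 * w ^ 2 * Z y ^ 2
      ≤ ∫ θ, Real.log (1 + w * (p y θ / mix p μ g y - 1)) ∂dens μ h := by
    have e : w * excess p μ h g y - 2 * w ^ 2 * Z y ^ 2
        = ∫ θ, (w * (p y θ / mix p μ g y - 1) - 2 * w ^ 2 * Z y ^ 2) ∂dens μ h := by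
      rw [integral_sub h3 (integrable_const _), integral_const_mul,
        integral_sub hpi (integrable_const _), integral_div, hh.integral_dens]
      simp [excess, mix]
    rw [e]
    refine integral_mono_ae (h3.sub (integrable_const _)) hli ?_
    filter_upwards [hratio] with θ h1
    exact log_step hw hw2 h1.2.2.2.1.le h1.2.2.2.2 (hp.one_le y)
  linarith

variable [SFinite μ]

/-- First-order optimality of a minimizer `h` of the divergence among the densities on `T`. -/
lemma integral_mix_div_le_one [IsProbabilityMeasure Q] (hp : RatioBound p S Z)
    (hZ : Integrable Z Q) (hZ2 : Integrable (fun x => Z x ^ 2) Q) {T : Set E} (hTS : T ⊆ S)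
    (hh : IsDensityOn μ T h) (hmin : ∀ g, IsDensityOn μ T g → 0 ≤ logRatio p μ Q h g)
    (hg : IsDensityOn μ T g) : ∫ x, mix p μ g x / mix p μ h x ∂Q ≤ 1 := by
  have hhS := hh.mono hTS
  have hgS := hg.mono hTS
  have hri : Integrable (fun x => mix p μ g x / mix p μ h x) Q := by
    refine hZ.mono' ((hp.measurable_mix hg.measurable).div
      (hp.measurable_mix hh.measurable)).aestronglyMeasurable (Eventually.of_forall fun x => ?_)
    rw [Real.norm_eq_abs, abs_of_pos (hp.mix_div_pos hhS hgS x)]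
    exact hp.mix_div_le hhS hgS x
  set C := ∫ x, Z x ^ 2 ∂Q
  set I := ∫ x, mix p μ g x / mix p μ h x ∂Q with hI
  -- Move from h towards g by a small t: minimality makes the change of the divergence nonnegative,
  -- while its expansion is −t(I − 1) + O(t²). Dividing by t and letting t → 0 gives I ≤ 1.
  have key : ∀ t : ℝ, 0 < t → t ≤ 1 / 2 → I - 1 ≤ 2 * t * C := by
    intro t ht ht2
    set u : E → ℝ := fun θ => (1 - t) * h θ + t * g θ
    have hint := (hh.integrable.const_mul (1 - t)).add (hg.integrable.const_mul t)
    have hu : IsDensityOn μ T u := by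
      refine .of_integral ((hh.measurable.const_mul _).add (hg.measurable.const_mul _))
        (fun θ => ?_) (fun θ hθ => by simp [u, hh.support θ hθ, hg.support θ hθ]) hint ?_
      · have := hh.nonneg θ
        have := hg.nonneg θ
        have : 0 ≤ 1 - t := by linarith
        positivity
      · simp only [u]
        rw [integral_add (hh.integrable.const_mul _) (hg.integrable.const_mul _),
          integral_const_mul, integral_const_mul, hh.integral_eq_one, hg.integral_eq_one]
        ring
    have hmixu : ∀ x, mix p μ u x / mix p μ h x = 1 + t * (mix p μ g x / mix p μ h x - 1) := by
      intro x
      have hx := hp.mix_pos hhS x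
      have : mix p μ u x = (1 - t) * mix p μ h x + t * mix p μ g x := by
        rw [mix, mix, mix, ← integral_const_mul, ← integral_const_mul, ← integral_add
          ((hp.integrable hhS x).const_mul _) ((hp.integrable hgS x).const_mul _)]
        congr 1 with θ
        simp only [u]; ring
      rw [this]; field_simp; ring
    -- The cocycle identity yields antisymmetry, so this is minimality of h tested at u.
    have h1 : logRatio p μ Q u h ≤ 0 := by
      have h2 := hp.logRatio_sub hZ (hu.mono hTS) hhS hhS
      have h3 := hp.logRatio_sub hZ hhS (hu.mono hTS) (hu.mono hTS)
      have h4 := hp.logRatio_sub hZ hhS (hu.mono hTS) hhS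
      have h5 := hp.logRatio_sub hZ hhS hhS hhS
      have := hmin u hu
      linarith
    have h3 : Integrable (fun x => t * (mix p μ g x / mix p μ h x - 1)) Q :=
      (hri.sub (integrable_const 1)).const_mul t
    have h4 : t * (I - 1) - 2 * t ^ 2 * C ≤ logRatio p μ Q u h := by
      have e : t * (I - 1) - 2 * t ^ 2 * C
          = ∫ x, (t * (mix p μ g x / mix p μ h x - 1) - 2 * t ^ 2 * Z x ^ 2) ∂Q := by
        rw [integral_sub h3 (hZ2.const_mul _), integral_const_mul, integral_const_mul,
          integral_sub hri (integrable_const _)]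
        simp [hI, C]
      rw [e]
      refine integral_mono (h3.sub (hZ2.const_mul _))
        (hp.integrable_log hZ hhS (hu.mono hTS)) fun x => ?_
      simp only
      rw [hmixu]
      exact log_step ht.le ht2 (hp.mix_div_pos hhS hgS x).le (hp.mix_div_le hhS hgS x)
        (hp.one_le x)
    have h5 : t * (I - 1) ≤ t * (2 * t * C) := by nlinarith
    exact le_of_mul_le_mul_left h5 ht
  have hlim : Tendsto (fun t : ℝ => 2 * t * C) (𝓝[>] 0) (𝓝 0) := by
    have : Tendsto (fun t : ℝ => 2 * t * C) (𝓝 0) (𝓝 (2 * 0 * C)) := by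
      exact ((continuous_const.mul continuous_id).mul continuous_const).tendsto 0
    rw [mul_zero, zero_mul] at this
    exact this.mono_left nhdsWithin_le_nhds
  have := ge_of_tendsto hlim (by
    filter_upwards [Ioc_mem_nhdsGT (show (0 : ℝ) < 1 / 2 by norm_num)] with t ht
    exact key t ht.1 ht.2)
  linarith

/-- The squared Hellinger distance to the projection is controlled by the excess divergence. -/
lemma hellinger_sq_le {ν : Measure χ} [SFinite ν] (hp : RatioBound p S Z)
    (hp1 : ∀ θ ∈ S, ∫⁻ x, ENNReal.ofReal (p x θ) ∂ν = 1) (hf : IsDensityOn μ S f)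
    (hZ : Integrable Z (dens ν (mix p μ f)))
    (hg : IsDensityOn μ S g) (hh : IsDensityOn μ S h)
    (hopt : ∫ x, mix p μ g x / mix p μ h x ∂dens ν (mix p μ f) ≤ 1)
    {c : ℝ} (hc : ∀ᵐ x ∂ν, c ≤ mix p μ f x / mix p μ h x) :
    c * hellinger ν (mix p μ h) (mix p μ g) ^ 2
      ≤ logRatio p μ (dens ν (mix p μ f)) h g := by
  have hm := hp.isDensityOn_mix hp1 hf
  have hprob := hm.isProbabilityMeasure
  set Q := dens ν (mix p μ f) with hQ
  have hmg := hp.measurable_mix (μ := μ) hg.measurable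
  have hmh := hp.measurable_mix (μ := μ) hh.measurable
  have hri : Integrable (fun x => mix p μ g x / mix p μ h x) Q := by
    refine hZ.mono' (hmg.div hmh).aestronglyMeasurable (Eventually.of_forall fun x => ?_)
    rw [Real.norm_eq_abs, abs_of_pos (hp.mix_div_pos hh hg x)]
    exact hp.mix_div_le hh hg x
  have hr0 : ∀ x, 0 < mix p μ g x / mix p μ h x := hp.mix_div_pos hh hg
  set s : χ → ℝ := fun x => (1 - Real.sqrt (mix p μ g x / mix p μ h x)) ^ 2 with hs
  have hsm : Measurable s := ((hmg.div hmh).sqrt.const_sub 1).pow_const 2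
  have hsi : Integrable s Q := by
    refine ((integrable_const 1).add hri).mono' hsm.aestronglyMeasurable
      (Eventually.of_forall fun x => ?_)
    have h1 := Real.sq_sqrt (hr0 x).le
    have h2 := Real.sqrt_nonneg (mix p μ g x / mix p μ h x)
    rw [Real.norm_eq_abs, abs_of_nonneg (sq_nonneg _)]
    simp only [Pi.add_apply]
    nlinarith
  -- With r = m_g/m_h, −log r = −2 log √r ≥ 2(1 − √r) = (1 − r) + (1 − √r)², and 1 − r has
  -- nonnegative mean by `hopt`.
  have h1 : ∫ x, s x ∂Q ≤ logRatio p μ Q h g := by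
    have hi : Integrable (fun x => 1 - mix p μ g x / mix p μ h x) Q :=
      (integrable_const 1).sub hri
    have h2 : ∫ x, ((1 - mix p μ g x / mix p μ h x) + s x) ∂Q ≤ logRatio p μ Q h g := by
      refine integral_mono (hi.add hsi)
        (hp.integrable_log hZ hg hh) fun x => ?_
      have hx := Real.sqrt_pos.2 (hr0 x)
      have h3 := Real.sq_sqrt (hr0 x).le
      have h4 := Real.log_le_sub_one_of_pos hx
      rw [Real.log_sqrt (hr0 x).le] at h4
      have h5 : Real.log (mix p μ h x / mix p μ g x)
          = - Real.log (mix p μ g x / mix p μ h x) := by rw [← Real.log_inv, inv_div]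
      simp only [hs]
      rw [h5]
      nlinarith
    rw [integral_add hi hsi,
      integral_sub (integrable_const 1) hri] at h2
    simp only [integral_const, probReal_univ, smul_eq_mul, mul_one] at h2
    linarith
  refine le_trans ?_ h1
  rw [hellinger, Real.sq_sqrt (integral_nonneg fun x => sq_nonneg _), hm.integral_dens,
    ← integral_const_mul]
  have hid := hm.integrable_dens_iff.1 hsi
  have hpt : ∀ x, s x * mix p μ f x = mix p μ f x / mix p μ h x *
      (Real.sqrt (mix p μ h x) - Real.sqrt (mix p μ g x)) ^ 2 := by
    intro x
    have hx := hp.mix_pos hh x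
    have h2 := Real.sq_sqrt hx.le
    have h3 := (Real.sqrt_pos.2 hx).ne'
    simp only [hs]
    rw [Real.sqrt_div (hp.mix_pos hg x).le]
    have h4 : mix p μ f x / mix p μ h x = mix p μ f x / Real.sqrt (mix p μ h x) ^ 2 := by rw [h2]
    rw [h4]
    field_simp
  simp_rw [hpt] at hid ⊢
  refine integral_mono_ae ?_ hid ?_
  · have h1 := hp.isDensityOn_mix hp1 hg
    have h2 := hp.isDensityOn_mix hp1 hh
    refine Integrable.const_mul (((h1.integrable.add h2.integrable)).mono'
      ((hmh.sqrt.sub hmg.sqrt).pow_const 2).aestronglyMeasurable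
      (Eventually.of_forall fun x => ?_)) c
    have h3 := Real.sq_sqrt (hp.mix_pos hg x).le
    have h4 := Real.sq_sqrt (hp.mix_pos hh x).le
    have h5 := Real.sqrt_nonneg (mix p μ g x)
    have h6 := Real.sqrt_nonneg (mix p μ h x)
    rw [Real.norm_eq_abs, abs_of_nonneg (sq_nonneg _)]
    simp only [Pi.add_apply, Pi.sub_apply]
    nlinarith [mul_nonneg h5 h6]
  · filter_upwards [hc] with x hx
    exact mul_le_mul_of_nonneg_right hx (sq_nonneg _)

end RatioBound

end Steps

/-! ### Convergence of centered series under finite-range dependence -/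

section Martingale

variable {Ω : Type*} {mΩ : MeasurableSpace Ω} {P : Measure Ω} [IsProbabilityMeasure P]

/-- A series of martingale differences with summable second moments converges almost surely. -/
theorem ae_tendsto_sum_of_condExp_eq_zero (ℋ : Filtration ℕ mΩ) {ξ : ℕ → Ω → ℝ}
    (hadp : ∀ k, StronglyMeasurable[ℋ (k + 1)] (ξ k)) (hL2 : ∀ k, MemLp (ξ k) 2 P)
    (h0 : ∀ k, P[ξ k | ℋ k] =ᵐ[P] 0) {c : ℕ → ℝ} (hc : ∀ k, ∫ ω, ξ k ω ^ 2 ∂P ≤ c k)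
    (hs : Summable c) :
    ∀ᵐ ω ∂P, ∃ l, Tendsto (fun n => ∑ k ∈ Finset.range n, ξ k ω) atTop (𝓝 l) := by
  set T : ℕ → Ω → ℝ := fun n ω => ∑ k ∈ Finset.range n, ξ k ω with hT
  have hTL2 : ∀ n, MemLp (T n) 2 P := fun n => memLp_finsetSum _ fun k _ => hL2 k
  have hTint : ∀ n, Integrable (T n) P := fun n => (hTL2 n).integrable (by norm_num)
  have hTadp : StronglyAdapted ℋ T := fun n =>
    Finset.stronglyMeasurable_fun_sum _ fun k hk =>
      (hadp k).mono (ℋ.mono (Finset.mem_range.1 hk))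
  have hsucc : ∀ n ω, T (n + 1) ω = T n ω + ξ n ω := fun n ω => Finset.sum_range_succ _ _
  have hmart : Martingale T ℋ P := by
    refine martingale_of_condExp_sub_eq_zero_nat hTadp hTint fun i => ?_
    have : T (i + 1) - T i = ξ i := by ext ω; simp [hsucc]
    rw [this]; exact h0 i
  -- Orthogonality of increments makes second moments add up; with |T| ≤ 1 + T² this bounds the
  -- martingale in L¹, and Doob's theorem applies.
  have horth : ∀ n, ∫ ω, T n ω * ξ n ω ∂P = 0 := by
    intro n
    have hi : Integrable (T n * ξ n) P := (hTL2 n).integrable_mul (hL2 n)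
    have h1 := condExp_mul_of_stronglyMeasurable_left (hTadp n) hi
      ((hL2 n).integrable (by norm_num))
    have h2 : P[T n * ξ n | ℋ n] =ᵐ[P] 0 := by
      filter_upwards [h1, h0 n] with ω h1 h2
      rw [h1, Pi.mul_apply, h2]; simp
    have h3 := integral_condExp (ℋ.le n) (f := T n * ξ n) (μ := P)
    rw [integral_congr_ae h2] at h3
    simpa using h3.symm
  have hsq : ∀ n, ∫ ω, T n ω ^ 2 ∂P ≤ ∑ k ∈ Finset.range n, c k := by
    intro n
    induction n with
    | zero => simp [hT]
    | succ n ih =>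
      have e : ∀ ω, T (n + 1) ω ^ 2 = T n ω ^ 2 + (2 * (T n ω * ξ n ω) + ξ n ω ^ 2) := by
        intro ω; rw [hsucc]; ring
      simp_rw [e]
      have i1 : Integrable (fun ω => T n ω * ξ n ω) P := (hTL2 n).integrable_mul (hL2 n)
      have i2 := (hL2 n).integrable_sq
      have i3 : Integrable (fun ω => 2 * (T n ω * ξ n ω) + ξ n ω ^ 2) P :=
        (i1.const_mul 2).add i2
      rw [integral_add (hTL2 n).integrable_sq i3, integral_add (i1.const_mul 2) i2,
        integral_const_mul, horth, Finset.sum_range_succ]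
      have := hc n
      linarith
  have hc0 : ∀ k, 0 ≤ c k := fun k => (integral_nonneg fun ω => sq_nonneg _).trans (hc k)
  refine hmart.submartingale.exists_ae_tendsto_of_bdd (R := Real.toNNReal (1 + ∑' k, c k))
    fun n => ?_
  rw [eLpNorm_one_eq_lintegral_enorm, ← ofReal_integral_norm_eq_lintegral_enorm (hTint n)]
  refine ENNReal.ofReal_le_ofReal ?_
  calc ∫ ω, ‖T n ω‖ ∂P ≤ ∫ ω, (1 + T n ω ^ 2) ∂P := by
        refine integral_mono (hTint n).norm ((integrable_const 1).add (hTL2 n).integrable_sq)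
          fun ω => ?_
        simp only [Real.norm_eq_abs]
        rw [← sq_abs]
        nlinarith [sq_nonneg (|T n ω| - 1)]
    _ ≤ 1 + ∑' k, c k := by
        rw [integral_add (integrable_const 1) (hTL2 n).integrable_sq]
        simp only [integral_const, probReal_univ, smul_eq_mul, mul_one]
        linarith [hsq n, hs.sum_le_tsum (Finset.range n) fun k _ => hc0 k]

/-- The same for differences which are centered given the past up to a gap `q`. -/
theorem ae_tendsto_sum_of_condExp_gap (ℱ : Filtration ℕ mΩ) {q : ℕ} (hq : 1 ≤ q)
    {ξ : ℕ → Ω → ℝ} (hadp : ∀ k, StronglyMeasurable[ℱ (k + q)] (ξ k))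
    (hL2 : ∀ k, MemLp (ξ k) 2 P) (h0 : ∀ k, P[ξ k | ℱ k] =ᵐ[P] 0) {c : ℕ → ℝ}
    (hc : ∀ k, ∫ ω, ξ k ω ^ 2 ∂P ≤ c k) (hs : Summable c) :
    ∀ᵐ ω ∂P, ∃ l, Tendsto (fun n => ∑ k ∈ Finset.range n, ξ k ω) atTop (𝓝 l) := by
  have hc0 : ∀ k, 0 ≤ c k := fun k => (integral_nonneg fun ω => sq_nonneg _).trans (hc k)
  have key : ∀ j : Fin q, ∀ᵐ ω ∂P, ∃ l, Tendsto
      (fun n => ∑ k ∈ Finset.range n, if k % q = j then ξ k ω else 0) atTop (𝓝 l) := by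
    intro j
    have hj := j.2
    -- r n is the least index ≥ n congruent to j mod q, also for n < j, where the truncated
    -- difference is 0. For k in the class of j, r k = k and r (k + 1) = k + q, so along ℱ ∘ r the
    -- terms of this class, with zeros elsewhere, are martingale differences.
    set r : ℕ → ℕ := fun n => j + q * ((n - j + q - 1) / q) with hr
    have hrm : Monotone r := by
      intro a b hab
      simp only [hr]
      gcongr
    let ℋ : Filtration ℕ mΩ := ⟨fun n => ℱ (r n), fun a b hab => ℱ.mono (hrm hab), fun n => ℱ.le _⟩
    refine ae_tendsto_sum_of_condExp_eq_zero (P := P) ℋ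
      (ξ := fun k ω => if k % q = j then ξ k ω else 0) (c := c) ?_ ?_ ?_ ?_ hs
    · intro k
      by_cases hk : k % q = j
      · simp only [hk, if_true]
        refine (hadp k).mono (ℱ.mono ?_)
        have h1 := Nat.div_add_mod k q
        have h2 : k + 1 - j + q - 1 = q * (k / q + 1) := by rw [mul_add]; omega
        have h3 : r (k + 1) = j + q * (k / q + 1) := by
          simp only [hr]; rw [h2, Nat.mul_div_cancel_left _ (by omega)]
        rw [h3, mul_add]; omega
      · simp only [hk, if_false]
        exact stronglyMeasurable_const
    · intro k
      by_cases hk : k % q = j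
      · simpa only [hk, if_true] using hL2 k
      · simp only [hk, if_false]; exact MemLp.zero'
    · intro k
      by_cases hk : k % q = j
      · simp only [hk, if_true]
        have h1 := Nat.div_add_mod k q
        have h2 : k - j + q - 1 = (q - 1) + q * (k / q) := by omega
        have h3 : r k = k := by
          simp only [hr]
          rw [h2, Nat.add_mul_div_left _ _ (by omega), Nat.div_eq_of_lt (by omega), zero_add]; omega
        change P[ξ k | ℱ (r k)] =ᵐ[P] 0
        rw [h3]; exact h0 k
      · simp only [hk, if_false]
        exact (condExp_zero (μ := P) (E := ℝ) (m := ℋ k)).eventuallyEq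
    · intro k
      by_cases hk : k % q = j
      · simpa only [hk, if_true] using hc k
      · simpa [hk] using hc0 k
  filter_upwards [ae_all_iff.2 key] with ω hω
  choose l hl using hω
  refine ⟨∑ j, l j, (tendsto_finsetSum Finset.univ fun j _ => hl j).congr fun n => ?_⟩
  rw [Finset.sum_comm]
  refine Finset.sum_congr rfl fun k _ => ?_
  have : ∀ j : Fin q, (k % q = (j : ℕ)) ↔ (⟨k % q, Nat.mod_lt k (by omega)⟩ : Fin q) = j :=
    fun j => by rw [Fin.ext_iff]
  simp [this]

/-- Centering over an independent argument gives a function with vanishing conditional mean. -/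
theorem condExp_sub_integral_eq_zero {β χ : Type*} [mβ : MeasurableSpace β] [MeasurableSpace χ]
    {Y : Ω → β} {X : Ω → χ} (hY : Measurable Y) (hX : Measurable X) (hind : IndepFun Y X P)
    {F : β → χ → ℝ} (hF : Measurable (Function.uncurry F))
    (hi : Integrable (fun ω => F (Y ω) (X ω)) P) :
    P[fun ω => F (Y ω) (X ω) - ∫ x, F (Y ω) x ∂P.map X | mβ.comap Y] =ᵐ[P] 0 := by
  have hpx := Measure.isProbabilityMeasure_map (μ := P) hX.aemeasurable
  have hpy := Measure.isProbabilityMeasure_map (μ := P) hY.aemeasurable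
  have hlaw := (indepFun_iff_map_prod_eq_prod_map_map hY.aemeasurable hX.aemeasurable).1 hind
  have hG : StronglyMeasurable fun y => ∫ x, F y x ∂P.map X :=
    hF.stronglyMeasurable.integral_prod_right
  have hi2 : Integrable (Function.uncurry F) ((P.map Y).prod (P.map X)) := by
    rw [← hlaw, integrable_map_measure hF.aestronglyMeasurable (hY.prodMk hX).aemeasurable]
    exact hi
  have hi3 : Integrable (fun ω => ∫ x, F (Y ω) x ∂P.map X) P := by
    have : Integrable (fun y => ∫ x, F y x ∂P.map X) (P.map Y) := hi2.integral_prod_left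
    rwa [integrable_map_measure hG.aestronglyMeasurable hY.aemeasurable] at this
  refine (ae_eq_condExp_of_forall_setIntegral_eq hY.comap_le (hi.sub hi3)
    (fun s _ _ => integrableOn_zero) ?_ aestronglyMeasurable_zero).symm
  rintro _ ⟨B, hB, rfl⟩ -
  have hBi : Integrable (fun z : β × χ => B.indicator (fun _ => (1 : ℝ)) z.1 * F z.1 z.2)
      ((P.map Y).prod (P.map X)) := by
    refine hi2.mono ((((measurable_const.indicator hB).comp measurable_fst).mul
      hF).aestronglyMeasurable) (Eventually.of_forall fun z => ?_)
    by_cases hz : z.1 ∈ B <;> simp [hz, Function.uncurry]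
  -- Fubini under the product law of (Y, X), with the indicator of B depending on Y alone.
  have e1 : ∫ ω in Y ⁻¹' B, F (Y ω) (X ω) ∂P
      = ∫ ω in Y ⁻¹' B, ∫ x, F (Y ω) x ∂P.map X ∂P := by
    rw [← integral_indicator (hY hB), ← integral_indicator (hY hB)]
    calc ∫ ω, (Y ⁻¹' B).indicator (fun ω => F (Y ω) (X ω)) ω ∂P
        = ∫ ω, (fun z : β × χ => B.indicator (fun _ => (1 : ℝ)) z.1 * F z.1 z.2)
            (Y ω, X ω) ∂P := by
          congr 1 with ω
          by_cases h : Y ω ∈ B <;> simp [h, Set.indicator]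
      _ = ∫ z, B.indicator (fun _ => (1 : ℝ)) z.1 * F z.1 z.2 ∂((P.map Y).prod (P.map X)) := by
          rw [← hlaw, integral_map (hY.prodMk hX).aemeasurable]
          rw [hlaw]; exact hBi.aestronglyMeasurable
      _ = ∫ y, B.indicator (fun _ => (1 : ℝ)) y * ∫ x, F y x ∂P.map X ∂P.map Y := by
          rw [integral_prod _ hBi]
          simp_rw [integral_const_mul]
      _ = ∫ ω, B.indicator (fun _ => (1 : ℝ)) (Y ω) * ∫ x, F (Y ω) x ∂P.map X ∂P := by
          rw [integral_map hY.aemeasurable]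
          exact ((measurable_const.indicator hB).mul hG.measurable).aestronglyMeasurable
      _ = _ := by
          congr 1 with ω
          by_cases h : Y ω ∈ B <;> simp [h, Set.indicator]
  simp only [Pi.sub_apply, integral_zero]
  rw [integral_sub hi.integrableOn hi3.integrableOn, e1, sub_self]

variable {χ : Type*} [MeasurableSpace χ] {X : ℕ → Ω → χ} {q : ℕ} {Q : Measure χ}

omit mΩ in
lemma measurable_freeze {α : Type*} {mα : MeasurableSpace α} {s : Set ℕ}
    [DecidablePred (· ∈ s)] (X : ℕ → α → χ) (x₀ : χ) (hX : ∀ i ∈ s, Measurable (X i)) :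
    Measurable fun a i => if i ∈ s then X i a else x₀ := by
  refine measurable_pi_lambda _ fun i => ?_
  by_cases hi : i ∈ s
  · simp only [hi, if_true]; exact hX i hi
  · simp only [hi, if_false]; exact measurable_const

/-- Weighted sums of centered functionals of a `(q - 1)`-dependent sequence converge. -/
theorem IsDependentOfGap.ae_tendsto_sum (hdep : IsDependentOfGap q X P) (hq : 1 ≤ q)
    (hX : ∀ i, Measurable (X i)) (hlaw : ∀ i, 1 ≤ i → P.map (X i) = Q)
    {F : ℕ → (ℕ → χ) → χ → ℝ} (hF : ∀ k, Measurable (Function.uncurry (F k)))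
    (hFdep : ∀ k y y', (∀ i ∈ Set.Icc 1 k, y i = y' i) → F k y = F k y')
    {Z : χ → ℝ} (hZ : MemLp Z 2 Q) (hFZ : ∀ k y x, |F k y x| ≤ Z x)
    {b : ℕ → ℝ} (hb : Summable fun k => b k ^ 2) :
    ∀ᵐ ω ∂P, ∃ l, Tendsto (fun n => ∑ k ∈ Finset.range n,
      b k * (F k (fun i => X i ω) (X (k + q) ω) - ∫ x, F k (fun i => X i ω) x ∂Q))
      atTop (𝓝 l) := by
  classical
  have hQ : IsProbabilityMeasure Q := by
    rw [← hlaw 1 le_rfl]; exact Measure.isProbabilityMeasure_map (hX 1).aemeasurable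
  have hZi : Integrable Z Q := hZ.integrable (by norm_num)
  obtain ⟨ω₀⟩ : Nonempty Ω := P.nonempty_of_neZero
  -- Coordinates outside 1, …, k are frozen at an arbitrary point. The past is then a single
  -- variable with values in ℕ → χ for every k, and `hFdep` says that F k does not notice the
  -- change.
  set fr : ℕ → (ℕ → χ) → ℕ → χ := fun k y i => if i ∈ Set.Icc 1 k then y i else X 0 ω₀ with hfr
  have hfrm : ∀ k, Measurable (fr k) := by
    intro k
    exact measurable_freeze (fun i (y : ℕ → χ) => y i) (X 0 ω₀) fun i _ => measurable_pi_apply i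
  set Y : ℕ → Ω → ℕ → χ := fun k ω => fr k fun i => X i ω with hYdef
  have hXm : Measurable fun ω i => X i ω := measurable_pi_lambda _ hX
  have hY : ∀ k, Measurable (Y k) := fun k => (hfrm k).comp hXm
  have hYF : ∀ k ω, F k (fun i => X i ω) = F k (Y k ω) := fun k ω =>
    hFdep k _ _ fun i hi => by simp only [hYdef, hfr, hi, if_true]
  have hcomp : ∀ k l, k ≤ l → Y k = fr k ∘ Y l := by
    intro k l hkl
    ext ω i
    simp only [hYdef, hfr, Function.comp]
    by_cases hi : i ∈ Set.Icc 1 k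
    · have : i ∈ Set.Icc 1 l := ⟨hi.1, hi.2.trans hkl⟩
      simp only [hi, this, if_true]
    · simp only [hi, if_false]
  have hYmeas : ∀ k l, k ≤ l → Measurable[MeasurableSpace.comap (Y l) inferInstance] (Y k) := by
    intro k l hkl
    rw [hcomp k l hkl]
    exact (hfrm k).comp (comap_measurable (Y l))
  let ℱ : Filtration ℕ mΩ := ⟨fun k => MeasurableSpace.comap (Y k) inferInstance,
    fun k l hkl => (hYmeas k l hkl).comap_le, fun k => (hY k).comap_le⟩
  have hXq : ∀ k, Measurable[ℱ (k + q)] (X (k + q)) := by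
    intro k
    have : X (k + q) = (fun y : ℕ → χ => y (k + q)) ∘ Y (k + q) := by
      ext ω
      have : k + q ∈ Set.Icc 1 (k + q) := ⟨by omega, le_rfl⟩
      simp only [hYdef, hfr, Function.comp, this, if_true]
    rw [this]
    exact (measurable_pi_apply (k + q)).comp (comap_measurable (Y (k + q)))
  have hlawk : ∀ k, P.map (X (k + q)) = Q := fun k => hlaw _ (by omega)
  have hind : ∀ k, IndepFun (Y k) (X (k + q)) P := by
    intro k
    have h := hdep k
    refine indep_of_indep_of_le_left (indep_of_indep_of_le_right h ?_) ?_
    · exact le_iSup₂_of_le (k + q) (Set.mem_Ici.2 le_rfl) le_rfl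
    · exact (measurable_freeze (mα := ⨆ i ∈ Set.Icc 1 k, MeasurableSpace.comap (X i) _)
        X (X 0 ω₀) fun i hi => (comap_measurable (X i)).mono (le_iSup₂
          (f := fun i (_ : i ∈ Set.Icc 1 k) => MeasurableSpace.comap (X i) _) i hi) le_rfl).comap_le
  set D : ℕ → Ω → ℝ := fun k ω => F k (Y k ω) (X (k + q) ω) - ∫ x, F k (Y k ω) x ∂Q with hD
  have hZX : ∀ k, MemLp (fun ω => Z (X (k + q) ω)) 2 P := by
    intro k
    rw [← hlawk k] at hZ
    exact hZ.comp_of_map (hX _).aemeasurable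
  have hDm : ∀ k, StronglyMeasurable[ℱ (k + q)] (D k) := by
    intro k
    have hG : StronglyMeasurable fun y => ∫ x, F k y x ∂Q :=
      (hF k).stronglyMeasurable.integral_prod_right
    have h1 : Measurable[ℱ (k + q)] fun ω => F k (Y k ω) (X (k + q) ω) :=
      (hF k).comp ((hYmeas k (k + q) (by omega)).prodMk (hXq k))
    have h2 : Measurable[ℱ (k + q)] fun ω => ∫ x, F k (Y k ω) x ∂Q :=
      hG.measurable.comp (hYmeas k (k + q) (by omega))
    exact (h1.sub h2).stronglyMeasurable
  have hIZ : ∀ k y, |∫ x, F k y x ∂Q| ≤ ∫ x, Z x ∂Q := by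
    intro k y
    rw [← Real.norm_eq_abs]
    refine norm_integral_le_of_norm_le hZi (Eventually.of_forall fun x => ?_)
    rw [Real.norm_eq_abs]; exact hFZ k y x
  have hDle : ∀ k ω, |D k ω| ≤ Z (X (k + q) ω) + ∫ x, Z x ∂Q := by
    intro k ω
    have h1 := abs_sub (F k (Y k ω) (X (k + q) ω)) (∫ x, F k (Y k ω) x ∂Q)
    have h2 := hFZ k (Y k ω) (X (k + q) ω)
    have h3 := hIZ k (Y k ω)
    simp only [hD]; linarith
  have hbd : ∀ k, MemLp (fun ω => Z (X (k + q) ω) + ∫ x, Z x ∂Q) 2 P := fun k =>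
    (hZX k).add (memLp_const _)
  have hDL : ∀ k, MemLp (D k) 2 P := fun k =>
    (hbd k).mono' ((hDm k).mono (ℱ.le _)).aestronglyMeasurable
      (Eventually.of_forall fun ω => hDle k ω)
  have hFi : ∀ k, Integrable (fun ω => F k (Y k ω) (X (k + q) ω)) P := fun k =>
    ((hZX k).integrable (by norm_num)).mono'
      ((hF k).comp ((hY k).prodMk (hX _))).aestronglyMeasurable
      (Eventually.of_forall fun ω => hFZ k _ _)
  set M : ℝ := ∫ x, (Z x + ∫ x, Z x ∂Q) ^ 2 ∂Q with hM
  have hZsq : Integrable (fun x => (Z x + ∫ x, Z x ∂Q) ^ 2) Q :=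
    (hZ.add (memLp_const _)).integrable_sq
  have hDsq : ∀ k, ∫ ω, D k ω ^ 2 ∂P ≤ M := by
    intro k
    have e : M = ∫ ω, (Z (X (k + q) ω) + ∫ x, Z x ∂Q) ^ 2 ∂P := by
      have h2 := hZsq.aestronglyMeasurable
      rw [hM, ← hlawk k, integral_map (hX _).aemeasurable]
      rw [hlawk k]; exact h2
    rw [e]
    refine integral_mono (hDL k).integrable_sq (hbd k).integrable_sq fun ω => ?_
    simp only
    rw [← sq_abs (D k ω)]
    exact pow_le_pow_left₀ (abs_nonneg _) (hDle k ω) 2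
  have key := ae_tendsto_sum_of_condExp_gap (P := P) ℱ hq (ξ := fun k ω => b k * D k ω)
    (c := fun k => b k ^ 2 * M) (fun k => (hDm k).const_mul (b k))
    (fun k => (hDL k).const_mul (b k)) (fun k => ?_) (fun k => ?_) (hb.mul_right M)
  · filter_upwards [key] with ω hω
    simp_rw [hYF]
    exact hω
  · have h1 := condExp_sub_integral_eq_zero (hY k) (hX (k + q)) (hind k) (hF k) (hFi k)
    rw [hlawk k] at h1
    have h2 := condExp_smul (μ := P) (b k) (D k) (ℱ k)
    have h3 : (fun ω => b k * D k ω) = b k • D k := rfl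
    rw [h3]
    filter_upwards [h1, h2] with ω h1 h2
    have h4 : (P[D k | ℱ k]) ω = 0 := h1
    rw [h2, Pi.smul_apply, h4]; simp
  · simp_rw [mul_pow]
    rw [integral_const_mul]
    exact mul_le_mul_of_nonneg_left (hDsq k) (sq_nonneg _)

omit [IsProbabilityMeasure P] in
/-- Weighted sums of identically distributed integrable terms converge. -/
theorem ae_summable_mul (hX : ∀ i, Measurable (X i)) (hlaw : ∀ i, 1 ≤ i → P.map (X i) = Q)
    {W : χ → ℝ} (hWm : Measurable W) (hW0 : ∀ x, 0 ≤ W x) (hW : Integrable W Q) {s : ℕ → ℝ}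
    (hs0 : ∀ k, 0 ≤ s k) (hs : Summable s) {j : ℕ} (hj : 1 ≤ j) :
    ∀ᵐ ω ∂P, Summable fun k => s k * W (X (k + j) ω) := by
  have h1 : ∀ k, ∫⁻ ω, ENNReal.ofReal (s k * W (X (k + j) ω)) ∂P
      = ENNReal.ofReal (s k) * ∫⁻ x, ENNReal.ofReal (W x) ∂Q := by
    intro k
    simp_rw [ENNReal.ofReal_mul (hs0 k)]
    have hm : Measurable fun ω => ENNReal.ofReal (W (X (k + j) ω)) :=
      hWm.ennreal_ofReal.comp (hX _)
    rw [lintegral_const_mul _ hm, ← hlaw (k + j) (by omega),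
      lintegral_map hWm.ennreal_ofReal (hX _)]
  have hm : ∀ k, Measurable fun ω => ENNReal.ofReal (s k * W (X (k + j) ω)) := fun k =>
    ((hWm.comp (hX _)).const_mul (s k)).ennreal_ofReal
  have h2 : ∫⁻ ω, ∑' k, ENNReal.ofReal (s k * W (X (k + j) ω)) ∂P ≠ ⊤ := by
    rw [lintegral_tsum fun k => (hm k).aemeasurable]
    simp_rw [h1]
    rw [ENNReal.tsum_mul_right]
    refine ENNReal.mul_ne_top hs.tsum_ofReal_ne_top ?_
    rw [← ofReal_integral_eq_lintegral_ofReal hW (Eventually.of_forall hW0)]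
    exact ENNReal.ofReal_ne_top
  filter_upwards [ae_lt_top (Measurable.tsum hm) h2] with ω hω
  have := ENNReal.summable_toReal hω.ne
  simpa only [ENNReal.toReal_ofReal (mul_nonneg (hs0 _) (hW0 _))] using this

end Martingale

/-! ### Deterministic sequences and power weights -/

section Sequences

/-- Deterministic almost-supermartingale lemma with a convergent series of perturbations. -/
lemma tendsto_and_summable_of_le {U e δ : ℕ → ℝ} {k₀ : ℕ} {l : ℝ} (hU : ∀ n, 0 ≤ U n)
    (hδ : ∀ n, 0 ≤ δ n) (he : Tendsto (fun n => ∑ k ∈ Finset.range n, e k) atTop (𝓝 l))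
    (h : ∀ k, k₀ ≤ k → U (k + 1) ≤ U k + e k - δ k) :
    (∃ L, Tendsto U atTop (𝓝 L)) ∧ Summable δ := by
  -- Subtracting the partial sums of the perturbations leaves a decreasing sequence, bounded below
  -- because U ≥ 0 and convergent partial sums are bounded.
  set A : ℕ → ℝ := fun n => U (n + k₀) - ∑ k ∈ Finset.range (n + k₀), e k with hA
  have hstep : ∀ n, A (n + 1) ≤ A n - δ (n + k₀) := by
    intro n
    have h1 := h (n + k₀) (by omega)
    have h2 : n + 1 + k₀ = n + k₀ + 1 := by omega
    simp only [hA]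
    rw [h2, Finset.sum_range_succ]
    linarith
  have hanti : Antitone A := antitone_nat_of_succ_le fun n => by
    have := hstep n; have := hδ (n + k₀); linarith
  obtain ⟨M, hM⟩ := he.bddAbove_range
  have hlow : ∀ n, -M ≤ A n := fun n => by
    have h1 := hM ⟨n + k₀, rfl⟩
    have h2 := hU (n + k₀)
    simp only [hA]; simp only at h1; linarith
  have hAlim := tendsto_atTop_ciInf hanti ⟨-M, by rintro _ ⟨n, rfl⟩; exact hlow n⟩
  constructor
  · refine ⟨(⨅ n, A n) + l, ?_⟩
    rw [← tendsto_add_atTop_iff_nat k₀]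
    refine (hAlim.add ((tendsto_add_atTop_iff_nat k₀).2 he)).congr fun n => ?_
    simp only [hA]; ring
  · rw [← summable_nat_add_iff k₀]
    refine summable_of_sum_range_le (c := A 0 + M) (fun n => hδ _) fun n => ?_
    have : ∑ k ∈ Finset.range n, δ (k + k₀) ≤ A 0 - A n := by
      induction n with
      | zero => simp
      | succ n ih => rw [Finset.sum_range_succ]; linarith [hstep n]
    linarith [hlow n]

/-- If L > 0, then eventually v ≥ L/(2a), so u/a is dominated by (2/L) u v and would be summable. -/
lemma eq_zero_of_tendsto_of_summable {a v u : ℕ → ℝ} {L : ℝ} (ha : ∀ n, 0 < n → 0 < a n)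
    (hv : ∀ n, 0 ≤ v n) (hu : ∀ᶠ n in atTop, 0 ≤ u n)
    (hL : Tendsto (fun n => a n * v n) atTop (𝓝 L)) (hs : Summable fun n => u n * v n)
    (hns : ¬ Summable fun n => u n / a n) : L = 0 := by
  have hL0 : 0 ≤ L := ge_of_tendsto hL (by
    filter_upwards [eventually_gt_atTop 0] with n hn
    exact mul_nonneg (ha n hn).le (hv n))
  by_contra hne
  have hpos : 0 < L := lt_of_le_of_ne hL0 (Ne.symm hne)
  refine hns ?_
  refine Summable.of_norm_bounded_eventually_nat (hs.mul_left (2 / L)) ?_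
  filter_upwards [hu, eventually_gt_atTop 0, hL.eventually_const_lt (half_lt_self hpos)]
    with n h1 h2 h3
  have h4 := ha n h2
  rw [Real.norm_of_nonneg (by positivity), div_mul_eq_mul_div, div_le_div_iff₀ h4 hpos]
  nlinarith

lemma exists_weight_bounds {w : ℕ → ℝ} {γ : ℝ} (hw0 : ∀ i, 1 ≤ i → 0 < w i)
    (hw : w =Θ[atTop] fun i : ℕ => (i : ℝ) ^ (-γ)) :
    ∃ c : ℝ, 0 < c ∧ ∀ᶠ n : ℕ in atTop, c * (n : ℝ) ^ (-γ) ≤ w n := by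
  obtain ⟨c, hc, h⟩ := hw.2.exists_pos
  refine ⟨c⁻¹, inv_pos.2 hc, ?_⟩
  filter_upwards [h.bound, eventually_ge_atTop 1] with n hn h1
  rw [Real.norm_of_nonneg (by positivity), Real.norm_of_nonneg (hw0 n h1).le] at hn
  rwa [inv_mul_le_iff₀ hc]

lemma weight_shift_ge {w : ℕ → ℝ} {γ c : ℝ} (hγ : 0 ≤ γ) (hc : 0 < c)
    (h : ∀ᶠ n : ℕ in atTop, c * (n : ℝ) ^ (-γ) ≤ w n) (q : ℕ) :
    ∀ᶠ n : ℕ in atTop, c * ((q : ℝ) + 1) ^ (-γ) * (n : ℝ) ^ (-γ) ≤ w (n + q) := by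
  filter_upwards [(tendsto_add_atTop_nat q).eventually h, eventually_ge_atTop 1] with n hn h1
  refine le_trans ?_ hn
  rw [mul_assoc, ← Real.mul_rpow (by positivity) (by positivity)]
  refine mul_le_mul_of_nonneg_left ?_ hc.le
  have h1' : (1 : ℝ) ≤ n := by exact_mod_cast h1
  refine Real.rpow_le_rpow_of_nonpos (by push_cast; positivity) ?_ (by linarith)
  push_cast
  nlinarith [(Nat.cast_nonneg q : (0 : ℝ) ≤ q)]

lemma rpow_succ_sub_le {n : ℕ} (hn : 1 ≤ n) {s : ℝ} (hs0 : 0 ≤ s) (hs1 : s ≤ 1) :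
    ((n + 1 : ℕ) : ℝ) ^ s - (n : ℝ) ^ s ≤ (n : ℝ) ^ (s - 1) := by
  have hn' : (0 : ℝ) < n := by exact_mod_cast hn
  have h1 : ((n + 1 : ℕ) : ℝ) = n * (1 + 1 / n) := by push_cast; field_simp
  have h2 := rpow_one_add_le_one_add_mul_self (s := 1 / (n : ℝ))
    (by have : 0 < 1 / (n : ℝ) := by positivity
        linarith) hs0 hs1
  rw [h1, Real.mul_rpow hn'.le (by positivity), Real.rpow_sub_one hn'.ne']
  have h3 : 0 < (n : ℝ) ^ s := by positivity
  have h4 : (1 + 1 / (n : ℝ)) ^ s ≤ 1 + 1 / n := by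
    refine h2.trans ?_
    have : s * (1 / (n : ℝ)) ≤ 1 * (1 / n) := mul_le_mul_of_nonneg_right hs1 (by positivity)
    linarith
  have h5 := mul_le_mul_of_nonneg_left h4 h3.le
  have h6 : (n : ℝ) ^ s * (1 + 1 / n) = (n : ℝ) ^ s + (n : ℝ) ^ s / n := by ring
  linarith

variable {w : ℕ → ℝ} {γ γ' : ℝ}

/-- The increment is at most n^{−γ'} ≤ n^{−γ}, and the weights have order n^{−γ}; a shift by q
changes only the constant. -/
lemma exists_rpow_diff_le (hw0 : ∀ i, 1 ≤ i → 0 < w i)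
    (hw : w =Θ[atTop] fun i : ℕ => (i : ℝ) ^ (-γ)) (hγ : 0 ≤ γ) (hγ' : γ ≤ γ') (hγ1 : γ' ≤ 1)
    (q : ℕ) : ∃ C : ℝ, 0 ≤ C ∧ ∀ᶠ n : ℕ in atTop,
      ((n + 1 : ℕ) : ℝ) ^ (1 - γ') - (n : ℝ) ^ (1 - γ') ≤ C * w (n + q) := by
  obtain ⟨c, hc, h⟩ := exists_weight_bounds hw0 hw
  refine ⟨(c * ((q : ℝ) + 1) ^ (-γ))⁻¹, by positivity, ?_⟩
  filter_upwards [weight_shift_ge hγ hc h q, eventually_ge_atTop 1] with n hn h1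
  have h1' : (1 : ℝ) ≤ n := by exact_mod_cast h1
  have hpos : 0 < c * ((q : ℝ) + 1) ^ (-γ) := by positivity
  refine (rpow_succ_sub_le h1 (by linarith) (by linarith)).trans ?_
  rw [inv_mul_eq_div, le_div_iff₀ hpos]
  refine le_trans ?_ hn
  rw [mul_comm]
  exact mul_le_mul_of_nonneg_left
    (Real.rpow_le_rpow_of_exponent_le h1' (by linarith)) hpos.le

/-- The terms are at least of order n^{γ'−γ−1}, an exponent that is at least −1. -/
lemma not_summable_weight_div (hw0 : ∀ i, 1 ≤ i → 0 < w i)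
    (hw : w =Θ[atTop] fun i : ℕ => (i : ℝ) ^ (-γ)) (hγ : 0 ≤ γ) (hγ' : γ ≤ γ') (q : ℕ) :
    ¬ Summable fun n : ℕ => w (n + q) / (n : ℝ) ^ (1 - γ') := by
  obtain ⟨c, hc, h⟩ := exists_weight_bounds hw0 hw
  have hpos : 0 < c * ((q : ℝ) + 1) ^ (-γ) := by positivity
  intro hs
  have h2 : Summable fun n : ℕ => (n : ℝ) ^ (-γ - (1 - γ')) := by
    refine Summable.of_norm_bounded_eventually_nat
      (hs.mul_left (c * ((q : ℝ) + 1) ^ (-γ))⁻¹) ?_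
    filter_upwards [weight_shift_ge hγ hc h q, eventually_ge_atTop 1] with n hn h1
    have h1' : (0 : ℝ) < n := by exact_mod_cast h1
    rw [Real.norm_of_nonneg (by positivity), Real.rpow_sub h1', ← mul_div_assoc, inv_mul_eq_div]
    refine div_le_div_of_nonneg_right ?_ (by positivity)
    rw [le_div_iff₀ hpos]; linarith
  rw [Real.summable_nat_rpow] at h2
  linarith

/-- Square summability of the weighted noise. The exponent 2(1 − γ' − γ) must lie below −1, which γ
> 3/4 ensures for every γ' > γ. -/
lemma summable_sq_rpow_mul_weight (hw : w =Θ[atTop] fun i : ℕ => (i : ℝ) ^ (-γ))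
    (h : 3 < 2 * (γ + γ')) (q : ℕ) :
    Summable fun k : ℕ => (((k + q : ℕ) : ℝ) ^ (1 - γ') * w (k + q)) ^ 2 := by
  refine (summable_nat_add_iff q (f := fun n : ℕ => ((n : ℝ) ^ (1 - γ') * w n) ^ 2)).2 ?_
  have h1 : Summable fun n : ℕ => (n : ℝ) ^ ((1 - γ' - γ) * 2) :=
    Real.summable_nat_rpow.2 (by linarith)
  refine summable_of_isBigO_nat h1 ?_
  have h2 := ((isBigO_refl (fun n : ℕ => (n : ℝ) ^ (1 - γ')) atTop).mul hw.1).pow 2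
  refine h2.trans (EventuallyEq.isBigO ?_)
  filter_upwards [eventually_ge_atTop 1] with n hn
  have hn' : (0 : ℝ) < n := by exact_mod_cast hn
  rw [← Real.rpow_add hn', ← Real.rpow_natCast, ← Real.rpow_mul hn'.le]
  congr 1

lemma summable_rpow_mul_weight_sq (hw : w =Θ[atTop] fun i : ℕ => (i : ℝ) ^ (-γ))
    (hγ1 : γ' ≤ 1) (h : 2 < γ' + 2 * γ) {q : ℕ} (hq : 1 ≤ q) :
    Summable fun k : ℕ => ((k + q : ℕ) : ℝ) ^ (1 - γ') * w (k + 1) ^ 2 := by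
  have h1 : Summable fun n : ℕ => (n : ℝ) ^ (1 - γ' - γ * 2) :=
    Real.summable_nat_rpow.2 (by linarith)
  have h2 : Summable fun n : ℕ => (n : ℝ) ^ (1 - γ') * w n ^ 2 := by
    refine summable_of_isBigO_nat h1 ?_
    refine ((isBigO_refl (fun n : ℕ => (n : ℝ) ^ (1 - γ')) atTop).mul (hw.1.pow 2)).trans
      (EventuallyEq.isBigO ?_)
    filter_upwards [eventually_ge_atTop 1] with n hn
    have hn' : (0 : ℝ) < n := by exact_mod_cast hn
    rw [← Real.rpow_natCast, ← Real.rpow_mul hn'.le, ← Real.rpow_add hn']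
    congr 1; push_cast; ring
  refine Summable.of_nonneg_of_le (fun k => by positivity) (fun k => ?_)
    (((summable_nat_add_iff 1).2 h2).mul_left ((q : ℝ) ^ (1 - γ')))
  rw [← mul_assoc, ← Real.mul_rpow (by positivity) (by positivity)]
  refine mul_le_mul_of_nonneg_right ?_ (sq_nonneg _)
  refine Real.rpow_le_rpow (by positivity) ?_ (by linarith)
  have : (1 : ℝ) ≤ q := by exact_mod_cast hq
  push_cast
  nlinarith [(Nat.cast_nonneg k : (0 : ℝ) ≤ k)]

end Sequences

/-! ### The recursion: measurability and the lagged inequality -/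

section Recursion

variable {χ E : Type*} [MeasurableSpace χ] [MeasurableSpace E]
  {μ : Measure E} {S : Set E} {p : χ → E → ℝ} {Z : χ → ℝ} {f₀ h : E → ℝ} {Q : Measure χ}
  {w : ℕ → ℝ}

omit [MeasurableSpace χ] in
lemma recursion_succ (y : ℕ → χ) (n : ℕ) : recursion p μ w f₀ y (n + 1)
    = update p μ (recursion p μ w f₀ y n) (w (n + 1)) (y (n + 1)) := rfl

omit [MeasurableSpace χ] in
lemma recursion_congr {y y' : ℕ → χ} {n : ℕ} (hy : ∀ i ∈ Set.Icc 1 n, y i = y' i) :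
    recursion p μ w f₀ y n = recursion p μ w f₀ y' n := by
  induction n with
  | zero => rfl
  | succ n ih =>
    rw [recursion_succ, recursion_succ, ih fun i hi => hy i ⟨hi.1, hi.2.trans (Nat.le_succ n)⟩,
      hy (n + 1) ⟨by omega, le_rfl⟩]

namespace RatioBound

lemma isDensityOn_recursion (hp : RatioBound p S Z) (hw0 : ∀ i, 1 ≤ i → 0 < w i)
    (hw1 : ∀ i, 1 ≤ i → w i ≤ 1) {T : Set E} (hTS : T ⊆ S) (hf₀ : IsDensityOn μ T f₀)
    (y : ℕ → χ) (n : ℕ) : IsDensityOn μ T (recursion p μ w f₀ y n) := by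
  have hpT : RatioBound p T Z := ⟨hp.meas, fun x θ hθ => hp.pos x θ (hTS hθ), hp.measZ, hp.one_le,
    fun x θ hθ η hη => hp.bound x θ (hTS hθ) η (hTS hη)⟩
  induction n with
  | zero => exact hf₀
  | succ n ih =>
    exact hpT.isDensityOn_update ih (hw0 _ (by omega)).le (hw1 _ (by omega)) _

variable {β : Type*} [MeasurableSpace β] [SFinite μ] {G : β → E → ℝ}

lemma measurable_mix_uncurry (hp : RatioBound p S Z) (hG : Measurable (Function.uncurry G)) :
    Measurable (Function.uncurry fun b x => mix p μ (G b) x) := by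
  refine (StronglyMeasurable.integral_prod_right
    (f := fun (z : β × χ) θ => p z.2 θ * G z.1 θ) ?_).measurable
  have h1 : Measurable fun z : (β × χ) × E => p z.1.2 z.2 :=
    hp.meas.comp (measurable_fst.snd.prodMk measurable_snd)
  have h2 : Measurable fun z : (β × χ) × E => G z.1.1 z.2 :=
    hG.comp (measurable_fst.fst.prodMk measurable_snd)
  exact (h1.mul h2).stronglyMeasurable

lemma measurable_excess_uncurry (hp : RatioBound p S Z) (hh : Measurable h)
    (hG : Measurable (Function.uncurry G)) :
    Measurable (Function.uncurry fun b x => excess p μ h (G b) x) :=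
  (((hp.measurable_mix (μ := μ) hh).comp measurable_snd).div
    (hp.measurable_mix_uncurry hG)).sub_const 1

lemma measurable_overlapExcess_uncurry [SFinite Q] (hp : RatioBound p S Z)
    (hG : Measurable (Function.uncurry G)) :
    Measurable (Function.uncurry fun b x => overlapExcess p μ Q (G b) x) := by
  have hm := hp.measurable_mix_uncurry (μ := μ) hG
  have hN : Measurable fun z : (β × χ) × χ =>
      ∫ θ, p z.2 θ * p z.1.2 θ * G z.1.1 θ ∂μ := by
    refine (StronglyMeasurable.integral_prod_right
      (f := fun (z : (β × χ) × χ) θ => p z.2 θ * p z.1.2 θ * G z.1.1 θ) ?_).measurable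
    have h1 : Measurable fun z : ((β × χ) × χ) × E => p z.1.2 z.2 :=
      hp.meas.comp (measurable_fst.snd.prodMk measurable_snd)
    have h2 : Measurable fun z : ((β × χ) × χ) × E => p z.1.1.2 z.2 :=
      hp.meas.comp (measurable_fst.fst.snd.prodMk measurable_snd)
    have h3 : Measurable fun z : ((β × χ) × χ) × E => G z.1.1.1 z.2 :=
      hG.comp (measurable_fst.fst.fst.prodMk measurable_snd)
    exact ((h1.mul h2).mul h3).stronglyMeasurable
  have h1 : Measurable fun z : (β × χ) × χ => mix p μ (G z.1.1) z.2 :=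
    hm.comp (measurable_fst.fst.prodMk measurable_snd)
  have h2 : Measurable fun z : (β × χ) × χ => mix p μ (G z.1.1) z.1.2 :=
    hm.comp (measurable_fst.fst.prodMk measurable_fst.snd)
  have : Measurable fun z : β × χ => ∫ x, overlap p μ (G z.1) x z.2 ∂Q :=
    (StronglyMeasurable.integral_prod_right (f := fun (z : β × χ) x => overlap p μ (G z.1) x z.2)
      (hN.div (h1.mul h2)).stronglyMeasurable).measurable
  exact this.sub_const 1

lemma measurable_recursion (hp : RatioBound p S Z) (hf₀ : Measurable f₀) (n : ℕ) :
    Measurable (Function.uncurry fun (y : ℕ → χ) θ => recursion p μ w f₀ y n θ) := by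
  induction n with
  | zero => exact hf₀.comp measurable_snd
  | succ n ih =>
    have hy : Measurable fun z : (ℕ → χ) × E => z.1 (n + 1) :=
      (measurable_pi_apply (n + 1)).comp measurable_fst
    have h1 : Measurable fun z : (ℕ → χ) × E => p (z.1 (n + 1)) z.2 :=
      hp.meas.comp (hy.prodMk measurable_snd)
    have h2 : Measurable fun z : (ℕ → χ) × E =>
        mix p μ (recursion p μ w f₀ z.1 n) (z.1 (n + 1)) :=
      (hp.measurable_mix_uncurry (μ := μ) ih).comp (measurable_fst.prodMk hy)
    exact (ih.const_mul _).add (((h1.mul ih).div h2).const_mul _)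

omit [SFinite μ] in
/-- The lagged one-step inequality: the drift may be evaluated `q` steps back. -/
lemma lagged_step (hp : RatioBound p S Z) (hf₀ : IsDensityOn μ S f₀)
    (hw0 : ∀ i, 1 ≤ i → 0 < w i) (hw1 : ∀ i, 1 ≤ i → w i ≤ 1) (hanti : AntitoneOn w (Set.Ici 1))
    {Φ : (E → ℝ) → χ → ℝ}
    (hΦ : ∀ {g h : E → ℝ}, IsDensityOn μ S g → IsDensityOn μ S h → ∀ {c : ℝ}, 1 ≤ c →
      (∀ θ, g θ ≤ c * h θ) → (∀ θ, h θ ≤ c * g θ) → ∀ x,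
      |Φ g x - Φ h x| ≤ (c ^ 3 - 1) * Z x)
    {q : ℕ} (hq : 1 ≤ q) {k : ℕ} (hk : w (k + 1) ≤ 1 / 2) (y : ℕ → χ) {u u' : ℝ}
    (hu : u' ≤ u - w (k + q) * Φ (recursion p μ w f₀ y (k + q - 1)) (y (k + q))
      + 2 * w (k + q) ^ 2 * Z (y (k + q)) ^ 2) :
    u' ≤ u - w (k + q) * Φ (recursion p μ w f₀ y k) (y (k + q))
      + 26 * q * (w (k + 1) ^ 2 * ∑ j ∈ Finset.range q, Z (y (k + (j + 1))) ^ 4) := by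
  set W4 := ∑ j ∈ Finset.range q, Z (y (k + (j + 1))) ^ 4 with hW
  have hwle : ∀ j, w (k + (j + 1)) ≤ w (k + 1) := fun j =>
    hanti (Set.mem_Ici.2 (by omega)) (Set.mem_Ici.2 (by omega)) (by omega)
  have hZ4 : ∀ j < q, Z (y (k + (j + 1))) ^ 4 ≤ W4 := fun j hj =>
    Finset.single_le_sum (f := fun j => Z (y (k + (j + 1))) ^ 4)
      (fun i _ => by positivity) (Finset.mem_range.2 hj)
  have hlast : k + q = k + (q - 1 + 1) := by omega
  have hq4 : Z (y (k + q)) ^ 4 ≤ W4 := by rw [hlast]; exact hZ4 (q - 1) (by omega)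
  have hwq : w (k + q) ≤ w (k + 1) := by rw [hlast]; exact hwle (q - 1)
  have hwpos := hw0 (k + 1) (by omega)
  have hwqpos := hw0 (k + q) (by omega)
  have hW0 : 0 ≤ W4 := Finset.sum_nonneg fun i _ => by positivity
  set x := y (k + q) with hx
  -- Telescope from f_k to f_{k+q−1}; each update changes the density by a factor at most 1 + 2vz
  -- either way, which moves Φ at x by O(v z³ Z x).
  have htel : ∀ r, r < q → |Φ (recursion p μ w f₀ y (k + r)) x - Φ (recursion p μ w f₀ y k) x|
      ≤ r * (26 * w (k + 1) * W4) := by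
    intro r
    induction r with
    | zero => simp
    | succ r ih =>
      intro hr
      have h1 := ih (by omega)
      have hd := hp.isDensityOn_recursion hw0 hw1 subset_rfl hf₀ y (k + r)
      have hd' := hp.isDensityOn_recursion hw0 hw1 subset_rfl hf₀ y (k + (r + 1))
      set v := w (k + (r + 1)) with hv
      set z := Z (y (k + (r + 1))) with hz
      have hvpos : 0 < v := hw0 _ (by omega)
      have hv1 : v ≤ w (k + 1) := hwle r
      have hz1 : 1 ≤ z := hp.one_le _
      have hx1 : 1 ≤ Z x := hp.one_le _
      have h2 := hΦ hd' hd (c := 1 + 2 * (v * z)) (by nlinarith [mul_pos hvpos (one_pos.trans_le hz1)])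
        (fun θ => hp.update_le hd hvpos.le _ θ) (fun θ => hp.le_update hd hvpos.le (hv1.trans hk) _ θ)
        x
      have h3 : ((1 + 2 * (v * z)) ^ 3 - 1) * Z x ≤ 26 * w (k + 1) * W4 := by
        have hvz : 0 < v * z := by positivity
        have hvlt : v ≤ 1 := by linarith
        have hz3 : z ≤ z ^ 3 := le_self_pow₀ hz1 (by norm_num)
        have hz23 : z ^ 2 ≤ z ^ 3 := pow_le_pow_right₀ hz1 (by norm_num)
        have hv2 : v ^ 2 ≤ v := by nlinarith
        have hv3 : v ^ 3 ≤ v := by nlinarith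
        have e1 : v ^ 2 * z ^ 2 ≤ v * z ^ 3 :=
          mul_le_mul hv2 hz23 (by positivity) hvpos.le
        have e2 : v ^ 3 * z ^ 3 ≤ v * z ^ 3 := mul_le_mul_of_nonneg_right hv3 (by positivity)
        have e3 : v * z ≤ v * z ^ 3 := mul_le_mul_of_nonneg_left hz3 hvpos.le
        -- 26 = 6 + 12 + 8, the three powers being absorbed into v z³ through v ≤ 1 ≤ z.
        have h4 : (1 + 2 * (v * z)) ^ 3 - 1 ≤ 26 * (v * z ^ 3) := by
          have : (1 + 2 * (v * z)) ^ 3 - 1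
              = 6 * (v * z) + 12 * (v ^ 2 * z ^ 2) + 8 * (v ^ 3 * z ^ 3) := by ring
          rw [this]; linarith
        -- The product is at most the fourth power of the larger factor, and both fourth powers
        -- occur in W4. This is why a fourth moment of Z is required.
        have h5 : z ^ 3 * Z x ≤ W4 := by
          rcases le_total z (Z x) with h | h
          · calc z ^ 3 * Z x ≤ Z x ^ 3 * Z x := by gcongr
              _ = Z x ^ 4 := by ring
              _ ≤ W4 := hq4
          · calc z ^ 3 * Z x ≤ z ^ 3 * z := by gcongr
              _ = z ^ 4 := by ring
              _ ≤ W4 := hZ4 r (by omega)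
        calc ((1 + 2 * (v * z)) ^ 3 - 1) * Z x ≤ 26 * (v * z ^ 3) * Z x := by gcongr
          _ = 26 * v * (z ^ 3 * Z x) := by ring
          _ ≤ 26 * w (k + 1) * W4 := by gcongr
      have h4 := abs_add_le (Φ (recursion p μ w f₀ y (k + (r + 1))) x
        - Φ (recursion p μ w f₀ y (k + r)) x)
        (Φ (recursion p μ w f₀ y (k + r)) x - Φ (recursion p μ w f₀ y k) x)
      rw [sub_add_sub_cancel] at h4
      push_cast
      linarith [h2.trans h3]
  have h1 := htel (q - 1) (by omega)
  have hkq : k + (q - 1) = k + q - 1 := by omega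
  rw [hkq, Nat.cast_sub hq, Nat.cast_one] at h1
  have h2 := (abs_le.1 h1).1
  have hq1 : (1 : ℝ) ≤ q := by exact_mod_cast hq
  have hx1 : 1 ≤ Z x := hp.one_le _
  have h3 : Z x ^ 2 ≤ W4 := (pow_le_pow_right₀ hx1 (by norm_num)).trans hq4
  have h4 : w (k + q) ^ 2 * Z x ^ 2 ≤ w (k + 1) ^ 2 * W4 := by gcongr
  have h5 : w (k + q) * (((q : ℝ) - 1) * (26 * w (k + 1) * W4))
      ≤ w (k + 1) * (((q : ℝ) - 1) * (26 * w (k + 1) * W4)) := by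
    refine mul_le_mul_of_nonneg_right hwq (mul_nonneg (by linarith) (by positivity))
  have h6 := mul_le_mul_of_nonneg_left h2 hwqpos.le
  have h7 : 0 ≤ w (k + 1) ^ 2 * W4 := by positivity
  -- The q − 1 replacements cost 26(q − 1) and the original remainder costs 2, together at most 26
  -- q.
  nlinarith

end RatioBound

end Recursion

/-! ### Almost sure summability and rate of the excess divergence -/

section Rate

variable {Ω χ E : Type*} [MeasurableSpace Ω] [MeasurableSpace χ] [MeasurableSpace E]
  {P : Measure Ω} [IsProbabilityMeasure P] {μ : Measure E} [SFinite μ] {S T : Set E}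
  {p : χ → E → ℝ} {Z : χ → ℝ} {f₀ h : E → ℝ} {Q : Measure χ} [IsProbabilityMeasure Q]
  {w : ℕ → ℝ} {X : ℕ → Ω → χ} {q : ℕ}

namespace RatioBound

/-- The weighted lagged noise and second-order terms form an almost surely convergent series. -/
theorem ae_tendsto_noise (hp : RatioBound p S Z) (hZ4 : MemLp Z 4 Q) (hq : 1 ≤ q)
    (hX : ∀ i, Measurable (X i)) (hdep : IsDependentOfGap q X P)
    (hlaw : ∀ i, 1 ≤ i → P.map (X i) = Q) (hf₀ : IsDensityOn μ S f₀) (hA1 : CondA1 q w)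
    {Φ : (E → ℝ) → χ → ℝ}
    (hΦm : ∀ {G : (ℕ → χ) → E → ℝ}, Measurable (Function.uncurry G) →
      Measurable (Function.uncurry fun y x => Φ (G y) x))
    (hΦ : ∀ {g : E → ℝ}, IsDensityOn μ S g → ∀ x, |Φ g x| ≤ Z x)
    {a : ℕ → ℝ} (ha : ∀ k, 0 ≤ a k) (ha1 : Summable fun k => (a k * w (k + q)) ^ 2)
    (ha2 : Summable fun k => a k * w (k + 1) ^ 2) :
    ∀ᵐ ω ∂P, ∃ l, Tendsto (fun n => ∑ k ∈ Finset.range n, a k *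
      (26 * q * (w (k + 1) ^ 2 * ∑ j ∈ Finset.range q, Z (X (k + (j + 1)) ω) ^ 4)
        - w (k + q) * (Φ (recursion p μ w f₀ (fun i => X i ω) k) (X (k + q) ω)
          - ∫ x, Φ (recursion p μ w f₀ (fun i => X i ω) k) x ∂Q))) atTop (𝓝 l) := by
  have h1 := hdep.ae_tendsto_sum hq hX hlaw
    (F := fun k y x => Φ (recursion p μ w f₀ y k) x) (Z := Z) (b := fun k => a k * w (k + q))
    (fun k => hΦm (hp.measurable_recursion hf₀.measurable k))
    (fun k y y' hy => by rw [recursion_congr hy])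
    (hZ4.mono_exponent (by norm_num))
    (fun k y x => hΦ (hp.isDensityOn_recursion hA1.pos hA1.le_one subset_rfl hf₀ y k) x) ha1
  have hW : Integrable (fun x => Z x ^ 4) Q := by
    have := hZ4.integrable_norm_pow (p := 4) (by norm_num)
    refine this.congr (Eventually.of_forall fun x => ?_)
    simp only
    rw [Real.norm_of_nonneg (hp.Z_pos x).le]
  have h2 : ∀ j : ℕ, ∀ᵐ ω ∂P, Summable fun k =>
      (a k * w (k + 1) ^ 2) * Z (X (k + (j + 1)) ω) ^ 4 := fun j =>
    ae_summable_mul hX hlaw (hp.measZ.pow_const 4) (fun x => by positivity) hW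
      (fun k => mul_nonneg (ha k) (sq_nonneg _)) ha2 (by omega)
  filter_upwards [h1, ae_all_iff.2 h2] with ω ⟨l, hl⟩ hω
  have h3 : Summable fun k => 26 * (q : ℝ) * ∑ j ∈ Finset.range q,
      (a k * w (k + 1) ^ 2) * Z (X (k + (j + 1)) ω) ^ 4 :=
    (summable_sum fun j _ => hω j).mul_left _
  refine ⟨_, (h3.hasSum.tendsto_sum_nat.sub hl).congr fun n => ?_⟩
  rw [← Finset.sum_sub_distrib]
  refine Finset.sum_congr rfl fun k _ => ?_
  rw [← Finset.mul_sum]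
  ring

/-- The weighted sum of the excess divergences is finite. -/
theorem ae_summable_excess (hp : RatioBound p S Z) (hZ4 : MemLp Z 4 Q) (hq : 1 ≤ q)
    (hX : ∀ i, Measurable (X i)) (hdep : IsDependentOfGap q X P)
    (hlaw : ∀ i, 1 ≤ i → P.map (X i) = Q) (hTS : T ⊆ S) (hf₀ : IsDensityOn μ T f₀)
    (hh : IsDensityOn μ T h) (hKL : KL μ h f₀ ≠ ⊤) (hA1 : CondA1 q w)
    (hmin : ∀ g, IsDensityOn μ T g → 0 ≤ logRatio p μ Q h g) :
    ∀ᵐ ω ∂P, Summable fun k =>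
      w (k + q) * logRatio p μ Q h (recursion p μ w f₀ (fun i => X i ω) k) := by
  have hZ : Integrable Z Q := hZ4.integrable (by norm_num)
  have hhS := hh.mono hTS
  have hnoise := hp.ae_tendsto_noise hZ4 hq hX hdep hlaw (hf₀.mono hTS) hA1
    (Φ := excess p μ h) (a := fun _ => 1) (fun hG => hp.measurable_excess_uncurry hh.measurable hG)
    (fun hg x => hp.abs_excess_le hg hhS x) (fun _ => zero_le_one)
    (by simpa only [one_mul] using (summable_nat_add_iff q).2 hA1.sq_summable)
    (by simpa only [one_mul] using (summable_nat_add_iff 1).2 hA1.sq_summable)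
  obtain ⟨N, hN⟩ := eventually_atTop.1
    (hA1.tendsto_zero.eventually_le_const (show (0 : ℝ) < 1 / 2 by norm_num))
  filter_upwards [hnoise] with ω ⟨l, hl⟩
  set y : ℕ → χ := fun i => X i ω with hy
  have hd : ∀ n, IsDensityOn μ T (recursion p μ w f₀ y n) :=
    hp.isDensityOn_recursion hA1.pos hA1.le_one hTS hf₀ y
  have hfin : ∀ n, KL μ h (recursion p μ w f₀ y n) ≠ ⊤ := by
    intro n
    induction n with
    | zero => exact hKL
    | succ n ih =>
      exact (hp.entropy_update ((hd n).mono hTS) hhS ih (hA1.pos _ (by omega)).le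
        (hA1.le_one _ (by omega)) _).1
  refine (tendsto_and_summable_of_le (k₀ := N)
    -- The index k + q − 1 makes the step from k to k + 1 consume exactly X_{k+q}, while the
    -- compensator δ is taken at the lagged density f_k.
    (U := fun k => (KL μ h (recursion p μ w f₀ y (k + q - 1))).toReal)
    (δ := fun k => w (k + q) * logRatio p μ Q h (recursion p μ w f₀ y k))
    (fun n => ENNReal.toReal_nonneg)
    (fun k => mul_nonneg (hA1.pos _ (by omega)).le (hmin _ (hd k))) hl fun k hk => ?_).2
  have hsucc : k + q = k + q - 1 + 1 := by omega
  have hwq : w (k + q) ≤ 1 / 2 := hN _ (by omega)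
  have h1 := (hp.entropy_update ((hd (k + q - 1)).mono hTS) hhS (hfin _)
    (hA1.pos (k + q) (by omega)).le (hA1.le_one (k + q) (by omega)) (y (k + q))).2 hwq
  have h2 : update p μ (recursion p μ w f₀ y (k + q - 1)) (w (k + q)) (y (k + q))
      = recursion p μ w f₀ y (k + 1 + q - 1) := by
    have : k + 1 + q - 1 = k + q - 1 + 1 := by omega
    rw [this, recursion_succ, ← hsucc]
  rw [h2] at h1
  have h3 := hp.lagged_step (hf₀.mono hTS) hA1.pos hA1.le_one hA1.anti (Φ := excess p μ h)
    (fun hg hg' _ hc h1 h2 x => hp.abs_excess_sub_le hg hg' hhS hc h1 h2 x) hq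
    (hN (k + 1) (by omega)) y h1
  have h4 := mul_le_mul_of_nonneg_left
    (hp.logRatio_le_integral_excess hZ ((hd k).mono hTS) hhS) (hA1.pos (k + q) (by omega)).le
  simp only [one_mul]
  linarith

/-- The almost sure rate of the excess divergence. -/
theorem ae_tendsto_rate (hp : RatioBound p S Z) (hZ4 : MemLp Z 4 Q) (hq : 1 ≤ q)
    (hX : ∀ i, Measurable (X i)) (hdep : IsDependentOfGap q X P)
    (hlaw : ∀ i, 1 ≤ i → P.map (X i) = Q) (hTS : T ⊆ S) (hf₀ : IsDensityOn μ T f₀)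
    (hh : IsDensityOn μ T h) (hKL : KL μ h f₀ ≠ ⊤) (hA1 : CondA1 q w)
    (hmin : ∀ g, IsDensityOn μ T g → 0 ≤ logRatio p μ Q h g)
    {γ γ' : ℝ} (hγ : 3 / 4 < γ) (hw : w =Θ[atTop] fun i : ℕ => (i : ℝ) ^ (-γ))
    (hγ' : γ < γ') (hγ1 : γ' < 1) :
    ∀ᵐ ω ∂P, Tendsto (fun n : ℕ => (n : ℝ) ^ (1 - γ')
      * logRatio p μ Q h (recursion p μ w f₀ (fun i => X i ω) n)) atTop (𝓝 0) := by
  have hZ : Integrable Z Q := hZ4.integrable (by norm_num)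
  have hhS := hh.mono hTS
  have hnoise := hp.ae_tendsto_noise hZ4 hq hX hdep hlaw (hf₀.mono hTS) hA1
    (Φ := overlapExcess p μ Q) (a := fun k => ((k + q : ℕ) : ℝ) ^ (1 - γ'))
    (fun hG => hp.measurable_overlapExcess_uncurry hG)
    (fun hg x => hp.abs_overlapExcess_le hg x) (fun _ => by positivity)
    (summable_sq_rpow_mul_weight hw (by linarith) q)
    (summable_rpow_mul_weight_sq hw hγ1.le (by linarith) hq)
  obtain ⟨C, hC, hdiff⟩ := exists_rpow_diff_le hA1.pos hw (by linarith) hγ'.le hγ1.le q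
  obtain ⟨N, hN⟩ := eventually_atTop.1 (hdiff.and
    (hA1.tendsto_zero.eventually_le_const (show (0 : ℝ) < 1 / 2 by norm_num)))
  filter_upwards [hnoise, hp.ae_summable_excess hZ4 hq hX hdep hlaw hTS hf₀ hh hKL hA1 hmin]
    with ω ⟨l, hl⟩ hsum
  set y : ℕ → χ := fun i => X i ω with hy
  have hd : ∀ n, IsDensityOn μ T (recursion p μ w f₀ y n) :=
    hp.isDensityOn_recursion hA1.pos hA1.le_one hTS hf₀ y
  set V : ℕ → ℝ := fun n => logRatio p μ Q h (recursion p μ w f₀ y n) with hV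
  have hV0 : ∀ n, 0 ≤ V n := fun n => hmin _ (hd n)
  have hshift : ∀ k, k + q - 1 = k + (q - 1) := fun k => by omega
  have hsum' : Summable fun k => C * (w (k + q - 1 + q) * V (k + q - 1)) := by
    simp_rw [hshift]
    exact ((summable_nat_add_iff (q - 1)).2 hsum).mul_left C
  have he := hsum'.hasSum.tendsto_sum_nat.add hl
  simp_rw [← Finset.sum_add_distrib] at he
  -- The perturbation at step k is the growth of the power weight times V, summable by the entropy
  -- argument, plus the lagged noise. The noise carries the weight (k + q)^{1−γ'} of the new
  -- iterate.
  obtain ⟨⟨L, hL⟩, -⟩ := tendsto_and_summable_of_le (k₀ := N)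
    (U := fun k => ((k + q - 1 : ℕ) : ℝ) ^ (1 - γ') * V (k + q - 1)) (δ := fun _ => 0)
    (fun n => mul_nonneg (by positivity) (hV0 _)) (fun _ => le_rfl) he fun k hk => by
      have hsucc : k + q = k + q - 1 + 1 := by omega
      have hwq : w (k + q) ≤ 1 / 2 := (hN _ (by omega)).2
      have h1 := hp.logRatio_update_le hZ ((hd (k + q - 1)).mono hTS) hhS
        (hA1.pos (k + q) (by omega)).le hwq (y (k + q))
      have hs1 : k + 1 + q - 1 = k + q := by omega
      have h2 : update p μ (recursion p μ w f₀ y (k + q - 1)) (w (k + q)) (y (k + q))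
          = recursion p μ w f₀ y (k + q) := by
        conv_rhs => rw [hsucc, recursion_succ, ← hsucc]
      rw [h2] at h1
      have h3 := hp.lagged_step (hf₀.mono hTS) hA1.pos hA1.le_one hA1.anti
        (Φ := overlapExcess p μ Q)
        (fun hg hg' _ hc h1 h2 x => hp.abs_overlapExcess_sub_le hg hg' hc h1 h2 x) hq
        (hN (k + 1) (by omega)).2 y h1
      -- The mean drift has the favorable sign and is simply dropped; no compensator is kept here.
      have h4 := mul_nonneg (hA1.pos (k + q) (by omega)).le
        (hp.integral_overlapExcess_nonneg hZ ((hd k).mono hTS))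
      have h5 := mul_le_mul_of_nonneg_right (hN (k + q - 1) (by omega)).1 (hV0 (k + q - 1))
      rw [← hsucc] at h5
      have h6 : (0 : ℝ) ≤ ((k + q : ℕ) : ℝ) ^ (1 - γ') := by positivity
      rw [hs1]
      change ((k + q : ℕ) : ℝ) ^ (1 - γ') * V (k + q) ≤ _
      change V (k + q) ≤ V (k + q - 1) - _ + _ at h3
      have h7 : V (k + q) - V (k + q - 1) ≤
          26 * q * (w (k + 1) ^ 2 * ∑ j ∈ Finset.range q, Z (y (k + (j + 1))) ^ 4)
          - w (k + q) * (overlapExcess p μ Q (recursion p μ w f₀ y k) (y (k + q))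
            - ∫ x, overlapExcess p μ Q (recursion p μ w f₀ y k) x ∂Q) := by linarith
      have h8 := mul_le_mul_of_nonneg_left h7 h6
      linarith
  have hL' : Tendsto (fun n : ℕ => (n : ℝ) ^ (1 - γ') * V n) atTop (𝓝 L) := by
    rw [← tendsto_add_atTop_iff_nat (q - 1)]
    refine hL.congr fun n => ?_
    rw [hshift]
  have hL0 : L = 0 := eq_zero_of_tendsto_of_summable (u := fun n => w (n + q))
    (fun n hn => Real.rpow_pos_of_pos (by exact_mod_cast hn) _) hV0
    (Eventually.of_forall fun n => (hA1.pos _ (by omega)).le) hL' hsum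
    (not_summable_weight_div hA1.pos hw (by linarith) hγ'.le q)
  rwa [hL0] at hL'

end RatioBound

end Rate

/-! ### Construction of the likelihood-ratio envelope -/

section Envelope

variable {χ E : Type*} [MeasurableSpace χ] [MeasurableSpace E] {μ : Measure E} [SFinite μ]
  {ν : Measure χ} [SFinite ν] {S Θ ΘH T : Set E} {p : χ → E → ℝ} {Z : χ → ℝ} {f : E → ℝ}
  {q : ℕ} {χc : Set χ}

/-- Likelihood ratios have a fourth moment under the mixture. -/
lemma RatioBound.memLp_ratio (hp : RatioBound p S Z) (hΘS : Θ ⊆ S) (hf : IsDensityOn μ Θ f)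
    (hq : 1 ≤ q) (hA4 : CondA4 p ν q T Θ) (hpos : ∀ x, ∀ θ ∈ T, 0 < p x θ) {θ₁ θ₂ : E}
    (h₁ : θ₁ ∈ T) (h₂ : θ₂ ∈ T) :
    MemLp (fun x => p x θ₁ / p x θ₂) 4 (dens ν (mix p μ f)) := by
  obtain ⟨B, hB, hA⟩ := hA4
  have hm : Measurable fun x => p x θ₁ / p x θ₂ := (hp.measurable_left _).div (hp.measurable_left _)
  have hm4 : Measurable fun x => ENNReal.ofReal ((p x θ₁ / p x θ₂) ^ 4) :=
    (hm.pow_const 4).ennreal_ofReal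
  refine ⟨hm.aestronglyMeasurable, ?_⟩
  rw [eLpNorm_lt_top_iff_lintegral_rpow_enorm_lt_top (by norm_num) (by norm_num)]
  have e1 : ∀ x, ‖p x θ₁ / p x θ₂‖ₑ ^ (4 : ℝ≥0∞).toReal
      = ENNReal.ofReal ((p x θ₁ / p x θ₂) ^ 4) := by
    intro x
    have h0 : 0 ≤ p x θ₁ / p x θ₂ := (div_pos (hpos x _ h₁) (hpos x _ h₂)).le
    rw [Real.enorm_eq_ofReal h0, ENNReal.ofReal_pow h0, ENNReal.toReal_ofNat]
    exact_mod_cast ENNReal.rpow_natCast _ 4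
  simp_rw [e1]
  have hmix := hp.measurable_mix (μ := μ) hf.measurable
  rw [dens, lintegral_withDensity_eq_lintegral_mul _ hmix.ennreal_ofReal hm4]
  simp only [Pi.mul_apply]
  have e2 : ∀ x, ENNReal.ofReal (mix p μ f x) * ENNReal.ofReal ((p x θ₁ / p x θ₂) ^ 4)
      = ∫⁻ θ, ENNReal.ofReal ((p x θ₁ / p x θ₂) ^ 4) * ENNReal.ofReal (p x θ)
          * ENNReal.ofReal (f θ) ∂μ := by
    intro x
    rw [hp.ofReal_mix (hf.mono hΘS), mul_comm, ← lintegral_const_mul]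
    · simp_rw [mul_assoc]
    · exact (hp.measurable_right x).ennreal_ofReal.mul hf.measurable.ennreal_ofReal
  simp_rw [e2]
  rw [lintegral_lintegral_swap]
  · calc ∫⁻ θ, ∫⁻ x, ENNReal.ofReal ((p x θ₁ / p x θ₂) ^ 4) * ENNReal.ofReal (p x θ)
          * ENNReal.ofReal (f θ) ∂ν ∂μ
        ≤ ∫⁻ θ, ENNReal.ofReal B * ENNReal.ofReal (f θ) ∂μ := by
          refine lintegral_mono fun θ => ?_
          have hmθ : Measurable fun x =>
              ENNReal.ofReal ((p x θ₁ / p x θ₂) ^ 4) * ENNReal.ofReal (p x θ) :=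
            hm4.mul (hp.measurable_left θ).ennreal_ofReal
          simp only
          rw [lintegral_mul_const _ hmθ]
          by_cases hθ : θ ∈ Θ
          · gcongr
            -- A4 is used with exponent 4, admissible since q ≥ 1.
            refine le_trans (le_of_eq ?_) (hA θ₁ h₁ θ₂ h₂ θ hθ 4 (by omega)).le
            congr 1 with x
            rw [ENNReal.ofReal_mul (by positivity)]
          · simp [hf.support θ hθ]
      _ = ENNReal.ofReal B := by
          rw [lintegral_const_mul _ hf.measurable.ennreal_ofReal, hf.total, mul_one]
      _ < ⊤ := ENNReal.ofReal_lt_top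
  · exact (((hm4.comp measurable_fst).mul hp.meas.ennreal_ofReal).mul
      (hf.measurable.ennreal_ofReal.comp measurable_snd)).aemeasurable

/-- Conditions C1–C3 bound the likelihood ratios on `S` by a function with a fourth moment. -/
theorem exists_ratioBound (hmeas : Measurable (Function.uncurry p)) (hH : ΘH.Finite)
    (hpos : ∀ x, ∀ θ ∈ S ∪ ΘH, 0 < p x θ) (hC1 : CondC1 p S ΘH χc) (hC2 : CondC2 p S χc)
    (hC3 : CondC3 p S χc) (hΘS : Θ ⊆ S) (hf : IsDensityOn μ Θ f) (hq : 1 ≤ q)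
    (hA4 : CondA4 p ν q (S ∪ ΘH) Θ) :
    ∃ Z : χ → ℝ, RatioBound p S Z ∧
      (IsProbabilityMeasure (dens ν (mix p μ f)) → MemLp Z 4 (dens ν (mix p μ f))) := by
  obtain ⟨cu, hcu, hC1⟩ := hC1
  obtain ⟨a, ha, hC2⟩ := hC2
  obtain ⟨b, hC3⟩ := hC3
  set I := hH.toFinset ×ˢ hH.toFinset with hI
  -- On χc the ratios are at most b/a. Off χc the pair given by C1 varies with x, perhaps not
  -- measurably; summing over all pairs of the finite set ΘH avoids a choice.
  set Z : χ → ℝ := fun x => max 1 (b / a) + ∑ s ∈ I, cu * (p x s.2 / p x s.1) with hZ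
  have hmem : ∀ s ∈ I, s.1 ∈ ΘH ∧ s.2 ∈ ΘH := fun s hs => by
    rw [hI, Finset.mem_product] at hs
    simpa using hs
  have hpl : ∀ θ, Measurable fun x => p x θ := fun θ => hmeas.comp measurable_prodMk_right
  have hterm : ∀ x, ∀ s ∈ I, 0 ≤ cu * (p x s.2 / p x s.1) := fun x s hs => by
    have h1 := hpos x _ (Or.inr (hmem s hs).1)
    have h2 := hpos x _ (Or.inr (hmem s hs).2)
    positivity
  have hsum0 : ∀ x, 0 ≤ ∑ s ∈ I, cu * (p x s.2 / p x s.1) := fun x => Finset.sum_nonneg (hterm x)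
  have hp : RatioBound p S Z := by
    refine ⟨hmeas, fun x θ hθ => hpos x θ (Or.inl hθ), ?_, fun x => ?_, fun x θ hθ η hη => ?_⟩
    · exact (Finset.measurable_fun_sum I fun s _ => ((hpl _).div (hpl _)).const_mul cu).const_add _
    · have := le_max_left 1 (b / a)
      have := hsum0 x
      simp only [hZ]; linarith
    · have hη0 := hpos x η (Or.inl hη)
      have hθ0 := hpos x θ (Or.inl hθ)
      rw [← div_le_iff₀ hη0]
      by_cases hx : x ∈ χc
      · have h1 := hC2 x hx η hη
        have h2 := hC3 x hx θ hθ
        have h3 : p x θ / p x η ≤ b / a := div_le_div₀ (hθ0.le.trans h2) h2 ha h1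
        have := le_max_right 1 (b / a)
        have := hsum0 x
        simp only [hZ]; linarith
      · obtain ⟨θ₁, h₁, θ₂, h₂, h⟩ := hC1 x hx
        have h1 : cu * (p x θ₂ / p x θ₁) ≤ ∑ s ∈ I, cu * (p x s.2 / p x s.1) :=
          Finset.single_le_sum (f := fun s : E × E => cu * (p x s.2 / p x s.1)) (hterm x)
            (a := (θ₁, θ₂)) (by simp [hI, h₁, h₂])
        have h2 := h θ hθ η hη
        have := le_max_left 1 (b / a)
        simp only [hZ]; linarith
  have hsum : MemLp (fun x => ∑ s ∈ I, cu * (p x s.2 / p x s.1)) 4 (dens ν (mix p μ f)) :=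
    memLp_finsetSum I fun s hs => (hp.memLp_ratio hΘS hf hq hA4 hpos (Or.inr (hmem s hs).2)
      (Or.inr (hmem s hs).1)).const_mul cu
  -- Total mass one matters only for the constant term; it is itself deduced from `RatioBound`,
  -- hence its place after the envelope.
  refine ⟨Z, hp, fun _ => ?_⟩
  have hconst : MemLp (fun _ : χ => max 1 (b / a)) 4 (dens ν (mix p μ f)) := memLp_const _
  exact hconst.add hsum

end Envelope

/-- Compare squares: H² = O(V) and V = o(n^{−s}), whence the halved exponent. -/
lemma isLittleO_rpow_of_mul_sq_le {V H : ℕ → ℝ} {c s : ℝ} (hc : 0 < c)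
    (h : ∀ n, c * H n ^ 2 ≤ V n) (hV : Tendsto (fun n : ℕ => (n : ℝ) ^ s * V n) atTop (𝓝 0)) :
    H =o[atTop] fun n : ℕ => (n : ℝ) ^ (-(s / 2)) := by
  refine IsLittleO.of_pow (n := 2) ?_ two_ne_zero
  have h1 : (fun n => H n ^ 2) =O[atTop] V := by
    refine IsBigO.of_bound c⁻¹ (Eventually.of_forall fun n => ?_)
    have h2 := h n
    have h3 : 0 ≤ c * H n ^ 2 := by positivity
    rw [Real.norm_of_nonneg (sq_nonneg _), Real.norm_of_nonneg (h3.trans h2), inv_mul_eq_div,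
      le_div_iff₀ hc]
    linarith
  refine h1.trans_isLittleO ?_
  rw [isLittleO_iff_tendsto']
  · refine hV.congr' ?_
    filter_upwards [eventually_gt_atTop 0] with n hn
    have hn' : (0 : ℝ) < n := by exact_mod_cast hn
    rw [Pi.pow_apply, ← Real.rpow_natCast, ← Real.rpow_mul hn'.le]
    have : -(s / 2) * ((2 : ℕ) : ℝ) = -s := by push_cast; ring
    rw [this, Real.rpow_neg hn'.le, div_inv_eq_mul, mul_comm]
  · filter_upwards [eventually_gt_atTop 0] with n hn h0
    have hn' : (0 : ℝ) < n := by exact_mod_cast hn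
    have : 0 < ((n : ℝ) ^ (-(s / 2))) ^ 2 := by positivity
    exact absurd h0 this.ne'

end PredRec

/-! ### Proof of the theorem -/

theorem mainTheorem7
    {Ω χ : Type*} [MeasurableSpace Ω] (P : Measure Ω) [IsProbabilityMeasure P]
    [TopologicalSpace χ] [MeasurableSpace χ] [BorelSpace χ] {d : ℕ}
    (ν : Measure χ) [SigmaFinite ν] (μ : Measure (PredRec.Par d)) [SigmaFinite μ]
    -- the parameter sets, the compact set of observations and the kernel
    (Θ Θ₀ Θhat ΘH : Set (PredRec.Par d)) (χc : Set χ) (p : χ → PredRec.Par d → ℝ)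
    (hΘ : IsCompact Θ) (hΘ₀ : IsCompact Θ₀)
    (hhat_closed : IsClosed Θhat) (hhat_convex : Convex ℝ Θhat)
    (hhat : Θ ∪ Θ₀ ⊆ Θhat) (hH : ΘH ⊆ Θhat) (hH_fin : ΘH.Finite) (hχc : IsCompact χc)
    (hp_meas : Measurable (Function.uncurry p))
    (hp_nonneg : ∀ x, ∀ θ ∈ Θhat, 0 ≤ p x θ)
    (hp_density : ∀ θ ∈ Θhat, ∫⁻ x, ENNReal.ofReal (p x θ) ∂ν = 1)
    (hp_pos : ∀ x, ∀ θ ∈ Θ ∪ Θ₀ ∪ ΘH, 0 < p x θ)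
    -- the observations `X 1, X 2, …`
    (q : ℕ) (hq : 1 ≤ q) (X : ℕ → Ω → χ) (hX_meas : ∀ i, Measurable (X i))
    (hX_dep : PredRec.IsDependentOfGap q X P)
    (f : PredRec.Par d → ℝ) (hf : PredRec.IsDensityOn μ Θ f)
    (hX_law : ∀ i, 1 ≤ i →
      P.map (X i) = ν.withDensity fun x => ENNReal.ofReal (PredRec.mix p μ f x))
    -- the weights, the starting density and the projection
    (γ : ℝ) (hγ : γ ∈ Set.Ioo (3 / 4 : ℝ) 1) (w : ℕ → ℝ)
    (hw : w =Θ[atTop] fun i : ℕ => (i : ℝ) ^ (-γ))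
    (f₀ : PredRec.Par d → ℝ) (hf₀ : PredRec.IsDensityOn μ Θ₀ f₀)
    (ft : PredRec.Par d → ℝ)
    (hft : PredRec.IsUniqueProjection p ν μ Θ₀ (PredRec.mix p μ f) ft)
    (hK₀ : PredRec.KL μ ft f₀ ≠ ⊤)
    (hA1 : PredRec.CondA1 q w) (hA2 : PredRec.CondA2 p ν μ Θ)
    (hA3 : PredRec.CondA3 p (Θ ∪ Θ₀)) (hA4 : PredRec.CondA4 p ν q (Θ ∪ Θ₀ ∪ ΘH) Θ)
    (hC1 : PredRec.CondC1 p (Θ ∪ Θ₀) ΘH χc) (hC2 : PredRec.CondC2 p (Θ ∪ Θ₀) χc)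
    (hC3 : PredRec.CondC3 p (Θ ∪ Θ₀) χc) :
    let m : χ → ℝ := PredRec.mix p μ f
    let mt : χ → ℝ := PredRec.mix p μ ft
    let mn : ℕ → Ω → χ → ℝ := fun n ω =>
      PredRec.mix p μ (PredRec.recursion p μ w f₀ (fun i => X i ω) n)
    let kt : ℝ≥0∞ := PredRec.kInf p ν μ Θ₀ m
    kt ≠ ⊤ ∧ (∀ᵐ ω ∂P, ∀ n, PredRec.KL ν m (mn n ω) ≠ ⊤) ∧
    ∀ γ' ∈ Set.Ioo γ 1,
      (∀ᵐ ω ∂P, Tendsto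
        (fun n : ℕ => (n : ℝ) ^ (1 - γ') * ((PredRec.KL ν m (mn n ω)).toReal - kt.toReal))
        atTop (𝓝 0)) ∧
      ((∃ c C : ℝ, 0 < c ∧ ∀ᵐ x ∂ν, c ≤ m x / mt x ∧ m x / mt x ≤ C) →
        ∀ᵐ ω ∂P, (fun n : ℕ => PredRec.hellinger ν mt (mn n ω))
          =o[atTop] fun n : ℕ => (n : ℝ) ^ (-((1 - γ') / 2))) := by

  intro m mt mn kt
  have hΘS : Θ ⊆ Θ ∪ Θ₀ := Set.subset_union_left
  have hΘ₀S : Θ₀ ⊆ Θ ∪ Θ₀ := Set.subset_union_right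
  obtain ⟨Z, hp, hZ4⟩ := PredRec.exists_ratioBound (ν := ν) hp_meas hH_fin hp_pos hC1 hC2 hC3 hΘS
    hf hq hA4
  have hp1 : ∀ θ ∈ Θ ∪ Θ₀, ∫⁻ x, ENNReal.ofReal (p x θ) ∂ν = 1 :=
    fun θ hθ => hp_density θ (hhat hθ)
  have hfS := hf.mono hΘS
  have hft₀ := hft.density
  have hftS := hft₀.mono hΘ₀S
  have hQ : IsProbabilityMeasure (PredRec.dens ν m) :=
    (hp.isDensityOn_mix hp1 hfS).isProbabilityMeasure
  replace hZ4 := hZ4 hQ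
  have hZ : Integrable Z (PredRec.dens ν m) := hZ4.integrable (by norm_num)
  have hKL : ∀ {g}, PredRec.IsDensityOn μ Θ₀ g → PredRec.KL ν m (PredRec.mix p μ g) ≠ ⊤ ∧
      (PredRec.KL ν m (PredRec.mix p μ g)).toReal
        = PredRec.logRatio p μ (PredRec.dens ν m) f g :=
    fun hg => hp.KL_mix hp1 hfS hZ (hg.mono hΘ₀S)
  have hkt_le : ∀ {g}, PredRec.IsDensityOn μ Θ₀ g → kt ≤ PredRec.KL ν m (PredRec.mix p μ g) :=
    fun {g} hg => iInf₂_le g hg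
  -- Every mixture over Θ₀ has finite divergence, its log ratio to m being dominated by Z; f₀ serves
  -- as competitor.
  have hkt : kt ≠ ⊤ := ne_top_of_le_ne_top (hKL hf₀).1 (hkt_le hf₀)
  -- The infimum is attained at `ft`, so the excess is a difference of two finite divergences and
  -- the cocycle identity applies.
  have hdiff : ∀ {g}, PredRec.IsDensityOn μ Θ₀ g →
      (PredRec.KL ν m (PredRec.mix p μ g)).toReal - kt.toReal
        = PredRec.logRatio p μ (PredRec.dens ν m) ft g := by
    intro g hg
    have h1 : kt = PredRec.KL ν m (PredRec.mix p μ ft) := hft.attains.symm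
    rw [h1, (hKL hg).2, (hKL hft₀).2, hp.logRatio_sub hZ (hg.mono hΘ₀S) hftS hfS]
  have hmin : ∀ g, PredRec.IsDensityOn μ Θ₀ g →
      0 ≤ PredRec.logRatio p μ (PredRec.dens ν m) ft g := by
    intro g hg
    rw [← hdiff hg, sub_nonneg]
    exact ENNReal.toReal_mono (hKL hg).1 (hkt_le hg)
  have hd : ∀ n ω, PredRec.IsDensityOn μ Θ₀ (PredRec.recursion p μ w f₀ (fun i => X i ω) n) :=
    fun n ω => hp.isDensityOn_recursion hA1.pos hA1.le_one hΘ₀S hf₀ _ n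
  refine ⟨hkt, Eventually.of_forall fun ω n => (hKL (hd n ω)).1, fun γ' hγ' => ?_⟩
  have hrate := hp.ae_tendsto_rate hZ4 hq hX_meas hX_dep hX_law hΘ₀S hf₀ hft₀ hK₀ hA1 hmin hγ.1 hw
    hγ'.1 hγ'.2
  refine ⟨?_, ?_⟩
  · filter_upwards [hrate] with ω hω
    refine hω.congr fun n => ?_
    rw [← hdiff (hd n ω)]
  · rintro ⟨c, C, hc, hcC⟩
    have hZ2 : Integrable (fun x => Z x ^ 2) (PredRec.dens ν m) :=
      (hZ4.mono_exponent (p := 2) (by norm_num)).integrable_sq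
    filter_upwards [hrate] with ω hω
    refine PredRec.isLittleO_rpow_of_mul_sq_le hc (fun n => ?_) hω
    exact hp.hellinger_sq_le hp1 hfS hZ ((hd n ω).mono hΘ₀S) hftS
      (hp.integral_mix_div_le_one hZ hZ2 hΘ₀S hft₀ hmin (hd n ω))
      (hcC.mono fun x hx => hx.1)
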